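/- Let $\mathcal H$ be a complex Hilbert space, $\mathcal D\subset\mathcal H$ a dense subspace, and $T(z)$, $z\in\mathbb C$, a family of closed operators on $\mathcal H$ with common domain $\mathcal D$ such that: (i) for all $f\in\mathcal D$, $g\in\mathcal H$, the function $z\mapsto\langle T(z)f,g\rangle$ (inner product linear in the first entry) is analytic on $\mathbb C$; (ii) for every $z\in\mathbb R$, $T(z)$ is self-adjoint and has discrete spectrum, i.e. its spectrum consists of isolated points that are eigenvalues of finite multiplicity; (iii) there is $C>0$ such that $\|T'(z)\|\le C$ for all $z\in\mathbb C$, where $T'(z):\mathcal D\to\mathcal H$ is the operator with $\langle T'(z)f,g\rangle=\frac{d}{dz}\langle T(z)f,g\rangle$, and the bound means $\|T'(z)f\|\le C\|f\|$ for all $f\in\mathcal D$. Let $(a,b)\subset\mathbb R$ be a nonempty open interval (possibly unbounded), $m\ge 1$ an integer, and $\mu:(a,b)\to\mathbb R$ a continuous function such that for every $z\in(a,b)$, $\mu(z)$ is an eigenvalue of $T(z)$ of multiplicity $m$. Then there exist a closed discrete set $D\subset\mathbb R$ and an open connected set $U\subset\mathbb C$ containing $(\mathbb R\setminus D)\cup(a,b)$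 such that $\mu$ extends to an analytic function $\mu:U\to\mathbb C$ with the following properties: - for all $z\in U$, $\mu(z)$ is an eigenvalue of $T(z)$ whose eigenspace has dimension $m$; - for all $z\in U$ there is an eigenprojector $\pi(z)$ of $T(z)$ associated to $\mu(z)$, i.e. a bounded projection with range $\ker(T(z)-\mu(z))$ and kernel $\operatorname{ran}(T(z)-\mu(z))$ (in particular, the algebraic multiplicity of $\mu(z)$ is also $m$), and $z\mapsto\pi(z)$ is analytic on $U$ in operator norm. -/

import Mathlib

open Filter Topology

namespace UnboundedOp

variable {H : Type*} [NormedAddCommGroup H] [InnerProductSpace ℂ H]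

/-- The operator `A - lam`, as a linear map from the domain of `A` to `H`. -/
def shift (A : H →ₗ.[ℂ] H) (lam : ℂ) : A.domain →ₗ[ℂ] H :=
  A.toFun - lam • A.domain.subtype

/-- `lam` is in the resolvent set of `A`: the map `A - lam : dom A → H` has an everywhere defined
bounded two-sided inverse. -/
def IsRegularValue (A : H →ₗ.[ℂ] H) (lam : ℂ) : Prop :=
  ∃ R : H →L[ℂ] H,
    (∀ y : H, ∃ f : A.domain, (f : H) = R y ∧ shift A lam f = y) ∧
      ∀ f : A.domain, R (shift A lam f) = f

/-- The spectrum of an (unbounded) operator: the complement of the resolvent set. -/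
def spec (A : H →ₗ.[ℂ] H) : Set ℂ :=
  {lam | ¬ IsRegularValue A lam}

/-- The eigenspace `ker (A - lam)`, as a subspace of `H`. -/
def eigenspace (A : H →ₗ.[ℂ] H) (lam : ℂ) : Submodule ℂ H :=
  (LinearMap.ker (shift A lam)).map A.domain.subtype

/-- `lam` is an eigenvalue of `A` whose eigenspace has finite dimension `m` (and `m ≠ 0`, as `lam`
is an eigenvalue). -/
def IsEigenvalueOfMultiplicity (A : H →ₗ.[ℂ] H) (lam : ℂ) (m : ℕ) : Prop :=
  m ≠ 0 ∧ Module.finrank ℂ (eigenspace A lam) = m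

/-- The spectrum is discrete: it consists of isolated points, each of them an eigenvalue of
finite multiplicity. -/
def HasDiscreteSpectrum (A : H →ₗ.[ℂ] H) : Prop :=
  ∀ lam ∈ spec A,
    (∀ᶠ w in 𝓝[≠] lam, w ∉ spec A) ∧ ∃ m : ℕ, IsEigenvalueOfMultiplicity A lam m

/-- `P` is the eigenprojector of `A` at `lam`: the bounded projection with range `ker (A - lam)`
and with kernel the range of `A - lam`. Such a `P` is unique. If it exists then the eigenvalue
`lam` is semisimple, that is, its algebraic and geometric multiplicities agree; for closed `A`
it is the Riesz spectral projection of `A` at `lam`, and for self-adjoint `A` it is the orthogonal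
projection onto the eigenspace. -/
def IsEigenprojector (A : H →ₗ.[ℂ] H) (lam : ℂ) (P : H →L[ℂ] H) : Prop :=
  P ∘L P = P ∧
    LinearMap.range (P : H →ₗ[ℂ] H) = eigenspace A lam ∧
    LinearMap.ker (P : H →ₗ[ℂ] H) = LinearMap.range (shift A lam)

/-- `T'` is the derivative at `z` of the family `T` of operators with common domain `D`: for
`f ∈ D` and `g ∈ H` the function `w ↦ ⟨T(w) f, g⟩` has derivative `⟨T' f, g⟩` at `z`. (Mathlib's
`inner ℂ g h` is linear in `h` and conjugate-linear in `g`.) -/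
def HasOpDerivAt {D : Submodule ℂ H} (T : ℂ → D →ₗ[ℂ] H) (T' : D →ₗ[ℂ] H) (z : ℂ) : Prop :=
  ∀ (f : D) (g : H), HasDerivAt (fun w => inner ℂ g (T w f)) (inner ℂ g (T' f)) z

end UnboundedOp

/-!
By Liouville's theorem the bounded derivative of the family is constant, so `T z = T 0 + z • B`
with `B` bounded and symmetric. Near a real point `x₀` the part of the spectrum of `T z` close to a
given eigenvalue of `T x₀` is cut off by an analytic finite rank projection, and Kato's reduction
process (subtract the scalar part, divide by `z - x₀`, split the spectrum again) turns this
compression into a finite sum of analytic eigenvalues times analytic projections: this is Rellich's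
theorem. By the Hellmann–Feynman formula eigenvalue branches are Lipschitz with constant `‖B‖`, so
that a branch cannot escape to infinity and continues along the whole real line, its multiplicity
changing only at a closed discrete set of crossings. The real branch extends to small complex discs
centred at real points, and the extensions agree on overlaps by the identity theorem; the union of
the discs stays connected when the crossings are removed from it.
-/

section Idempotents

theorem eq_zero_of_isIdempotentElem_of_norm_lt_one {A : Type*} [NonUnitalNormedRing A] {e : A}
    (he : IsIdempotentElem e) (h : ‖e‖ < 1) : e = 0 := by
  have h1 : ‖e‖ ≤ ‖e‖ * ‖e‖ := by simpa only [he.eq] using norm_mul_le e e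
  exact norm_le_zero_iff.1 (by nlinarith [norm_nonneg e])

theorem eq_of_isIdempotentElem_of_norm_sub_lt_one {A : Type*} [NormedRing A] {p q : A}
    (hp : IsIdempotentElem p) (hq : IsIdempotentElem q) (hc : Commute p q) (h : ‖p - q‖ < 1) :
    p = q := by
  have hcube : (p - q) * (p - q) * (p - q) = p - q := by
    have h1 : p * q * p = p * q := by rw [mul_assoc, ← hc.eq, ← mul_assoc, hp.eq]
    have h2 : p * q * q = p * q := by rw [mul_assoc, hq.eq]
    simp only [sub_mul, mul_sub, hp.eq, hq.eq, ← hc.eq, h1, h2]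
    abel
  have hidem : IsIdempotentElem ((p - q) * (p - q)) := by
    rw [IsIdempotentElem, ← mul_assoc, hcube]
  have hzero := eq_zero_of_isIdempotentElem_of_norm_lt_one hidem
    ((norm_mul_le _ _).trans_lt (by nlinarith [norm_nonneg (p - q)]))
  rw [hzero, zero_mul] at hcube
  exact sub_eq_zero.1 hcube.symm

theorem isIdempotentElem_inv_two_smul_one_add {𝕜 A : Type*} [Field 𝕜] [NeZero (2 : 𝕜)]
    [Ring A] [Algebra 𝕜 A] {s : A} (h : s ^ 2 = 1) :
    IsIdempotentElem ((2⁻¹ : 𝕜) • (1 + s)) := by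
  have h2 : (2 : 𝕜) ≠ 0 := two_ne_zero
  have hs : (1 + s) * (1 + s) = (2 : 𝕜) • (1 + s) := by
    rw [two_smul, mul_add, add_mul, add_mul, one_mul, mul_one, one_mul, ← sq, h]
    abel
  rw [IsIdempotentElem, smul_mul_smul_comm, hs, smul_smul, mul_assoc, inv_mul_cancel₀ h2, mul_one]

/-- The generating function `∑ (2n choose n) Xⁿ`, that is `(1 - 4 X) ^ (-1 / 2)`. -/
noncomputable def centralBinomSeries : PowerSeries ℤ :=
  PowerSeries.mk fun n => (n.centralBinom : ℤ)

theorem constantCoeff_centralBinomSeries :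
    PowerSeries.constantCoeff centralBinomSeries = 1 := by
  rw [← PowerSeries.coeff_zero_eq_constantCoeff_apply, centralBinomSeries, PowerSeries.coeff_mk,
    Nat.centralBinom_zero, Nat.cast_one]

open PowerSeries in
theorem derivative_centralBinomSeries :
    (1 - 4 * X) * d⁄dX ℤ centralBinomSeries = 2 * centralBinomSeries := by
  rw [show (4 : ℤ⟦X⟧) = C 4 from rfl, show (2 : ℤ⟦X⟧) = C 2 from rfl]
  ext n
  have hrec : ((n : ℤ) + 1) * (n + 1).centralBinom = 2 * (2 * n + 1) * n.centralBinom := mod_cast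
    n.succ_mul_centralBinom_succ
  simp only [centralBinomSeries, sub_mul, one_mul, mul_assoc, map_sub, coeff_C_mul,
    coeff_derivative, coeff_mk]
  cases n with
  | zero => simpa using hrec
  | succ n =>
    simp only [coeff_succ_X_mul, coeff_derivative, coeff_mk]
    push_cast at hrec ⊢
    linarith

open PowerSeries in
theorem one_sub_mul_centralBinomSeries_sq : (1 - 4 * X) * centralBinomSeries ^ 2 = 1 := by
  refine derivative.ext ?_ (by simp [constantCoeff_centralBinomSeries])
  have hd : d⁄dX ℤ (1 - 4 * X) = -4 := by
    rw [show (4 : ℤ⟦X⟧) = C 4 from rfl, map_sub, Derivation.leibniz, derivative_C,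
      derivative_X, Derivation.map_one_eq_zero]
    simp
  simp only [Derivation.leibniz, hd, sq, smul_eq_mul, Derivation.map_one_eq_zero]
  linear_combination 2 * centralBinomSeries * derivative_centralBinomSeries

theorem sum_antidiagonal_centralBinom_mul (n : ℕ) :
    ∑ kl ∈ Finset.HasAntidiagonal.antidiagonal n, kl.1.centralBinom * kl.2.centralBinom =
      4 ^ n := by
  have hcoeff : ∀ k, PowerSeries.coeff k (centralBinomSeries ^ 2) = 4 ^ k := by
    have h := one_sub_mul_centralBinomSeries_sq
    rw [sub_mul, one_mul, sub_eq_iff_eq_add, mul_assoc,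
      show (4 : PowerSeries ℤ) = PowerSeries.C 4 from rfl] at h
    intro k
    induction k with
    | zero => simp [constantCoeff_centralBinomSeries]
    | succ k ih =>
      rw [h, map_add, PowerSeries.coeff_C_mul, PowerSeries.coeff_succ_X_mul, ih,
        PowerSeries.coeff_one, if_neg k.succ_ne_zero, zero_add, pow_succ']
  have h := hcoeff n
  simp only [sq, PowerSeries.coeff_mul, centralBinomSeries, PowerSeries.coeff_mk] at h
  exact_mod_cast h

/-- The sum `∑ (2n choose n) xⁿ`, which represents `(1 - 4 x) ^ (-1 / 2)` for `‖x‖ < 1 / 4`. -/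
noncomputable def invSqrtOneSubFour {A : Type*} [NormedRing A] (x : A) : A :=
  ∑' n : ℕ, (n.centralBinom : A) * x ^ n

variable {A : Type*} [NormedRing A]

theorem norm_centralBinom_mul_pow_le (x : A) {n : ℕ} (hn : n ≠ 0) :
    ‖(n.centralBinom : A) * x ^ n‖ ≤ (4 * ‖x‖) ^ n := by
  rw [← nsmul_eq_mul, mul_pow]
  refine (norm_nsmul_le).trans ?_
  gcongr
  · exact_mod_cast n.centralBinom_le_four_pow
  · exact norm_pow_le' x (Nat.pos_of_ne_zero hn)

theorem summable_norm_centralBinom_mul_pow {x : A} (hx : ‖x‖ < 1 / 4) :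
    Summable fun n : ℕ => ‖(n.centralBinom : A) * x ^ n‖ := by
  refine (summable_nat_add_iff 1).1 (.of_nonneg_of_le (fun _ => norm_nonneg _)
    (fun n => norm_centralBinom_mul_pow_le x n.succ_ne_zero) ?_)
  exact (summable_nat_add_iff 1).2
    (summable_geometric_of_lt_one (by positivity) (by linarith))

theorem commute_invSqrtOneSubFour {x y : A} (h : Commute x y) :
    Commute (invSqrtOneSubFour x) y :=
  .tsum_left _ fun n => (Nat.cast_commute _ _).mul_left (h.pow_left n)

theorem commute_two_mul_sub_one_invSqrtOneSubFour (q : A) :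
    Commute (2 * q - 1) (invSqrtOneSubFour (q - q ^ 2)) :=
  (commute_invSqrtOneSubFour (commute_iff_eq _ _ |>.2 (by noncomm_ring))).symm

theorem isSelfAdjoint_invSqrtOneSubFour [StarRing A] [ContinuousStar A] {x : A}
    (h : IsSelfAdjoint x) : IsSelfAdjoint (invSqrtOneSubFour x) := by
  rw [IsSelfAdjoint, invSqrtOneSubFour, tsum_star]
  refine tsum_congr fun n => ?_
  rw [star_mul, star_natCast, star_pow, h.star_eq, Nat.cast_comm]

theorem norm_sub_sq_le_of_isIdempotentElem {p q : A} (hp : IsIdempotentElem p) (hpn : ‖p‖ ≤ 1) :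
    ‖q - q ^ 2‖ ≤ ‖q - p‖ * (3 + ‖q - p‖) := by
  set d := q - p with hd
  have hq : q - q ^ 2 = d - p * d - d * p - d * d := by
    rw [show q = p + d by rw [hd]; abel, sq]
    simp only [add_mul, mul_add, hp.eq]
    abel
  have h1 := norm_sub_le (d - p * d - d * p) (d * d)
  have h2 := norm_sub_le (d - p * d) (d * p)
  have h3 := norm_sub_le d (p * d)
  have h4 := norm_mul_le p d
  have h5 := norm_mul_le d p
  have h6 := norm_mul_le d d
  rw [hq]
  nlinarith [norm_nonneg d]

/-- The idempotent near an approximate idempotent `q`. It comes from normalising `s = 2 q - 1`,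
for which `s ^ 2 = 1 - 4 (q - q ^ 2)`, to `s (s ^ 2) ^ (-1 / 2)`. -/
noncomputable def idempotentNear (𝕜 : Type*) {A : Type*} [RCLike 𝕜] [NormedRing A]
    [NormedAlgebra 𝕜 A] (q : A) : A :=
  (2⁻¹ : 𝕜) • (1 + (2 * q - 1) * invSqrtOneSubFour (q - q ^ 2))

variable {𝕜 : Type*} [RCLike 𝕜] [NormedAlgebra 𝕜 A] {q : A}

theorem commute_idempotentNear {y : A} (h : Commute q y) : Commute (idempotentNear 𝕜 q) y := by
  have h2 : Commute (2 * q - 1) y :=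
    ((Commute.ofNat_left 2 y).mul_left h).sub_left (.one_left y)
  have hs := commute_invSqrtOneSubFour (h.sub_left (h.pow_left 2))
  exact ((Commute.one_left y).add_left (h2.mul_left hs)).smul_left _

theorem isSelfAdjoint_idempotentNear [StarRing A] [ContinuousStar A] [StarModule 𝕜 A]
    (h : IsSelfAdjoint q) : IsSelfAdjoint (idempotentNear 𝕜 q) := by
  have h2 : IsSelfAdjoint (2 * q - 1) := by
    rw [two_mul]
    exact (h.add h).sub (.one A)
  have hs := isSelfAdjoint_invSqrtOneSubFour (h.sub (h.pow 2))
  have hmul := (h2.commute_iff hs).1 (commute_two_mul_sub_one_invSqrtOneSubFour q)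
  have hstar : star (2⁻¹ : 𝕜) = 2⁻¹ := by rw [star_inv₀, star_ofNat]
  rw [IsSelfAdjoint, idempotentNear, star_smul, hstar, star_add, star_one, hmul.star_eq]

variable [CompleteSpace A]

theorem invSqrtOneSubFour_sq_mul {x : A} (hx : ‖x‖ < 1 / 4) :
    (1 - 4 * x) * invSqrtOneSubFour x ^ 2 = 1 := by
  have hsum := summable_norm_centralBinom_mul_pow hx
  have hx4 : ‖4 * x‖ < 1 := by
    have h4 : ‖4 * x‖ ≤ 4 * ‖x‖ := by simpa using norm_nsmul_le (n := 4) (a := x)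
    linarith
  have hsq : invSqrtOneSubFour x ^ 2 = ∑' n : ℕ, (4 * x) ^ n := by
    rw [sq, invSqrtOneSubFour, tsum_mul_tsum_eq_tsum_sum_antidiagonal_of_summable_norm hsum hsum]
    refine tsum_congr fun n => ?_
    calc ∑ kl ∈ Finset.HasAntidiagonal.antidiagonal n,
          (kl.1.centralBinom : A) * x ^ kl.1 * (kl.2.centralBinom * x ^ kl.2)
        = ∑ kl ∈ Finset.HasAntidiagonal.antidiagonal n,
          ((kl.1.centralBinom * kl.2.centralBinom : ℕ) : A) * x ^ n := by
          refine Finset.sum_congr rfl fun kl hkl => ?_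
          rw [(Nat.cast_commute _ (x ^ kl.1)).symm.mul_mul_mul_comm, ← pow_add,
            Finset.HasAntidiagonal.mem_antidiagonal.1 hkl, Nat.cast_mul]
      _ = (4 * x) ^ n := by
          rw [← Finset.sum_mul, ← Nat.cast_sum, sum_antidiagonal_centralBinom_mul,
            (Commute.ofNat_left 4 x).mul_pow, Nat.cast_pow, Nat.cast_ofNat]
  rw [hsq, mul_neg_geom_series _ hx4]

theorem norm_invSqrtOneSubFour_sub_one_le {x : A} (hx : ‖x‖ < 1 / 4) :
    ‖invSqrtOneSubFour x - 1‖ ≤ 4 * ‖x‖ / (1 - 4 * ‖x‖) := by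
  rw [invSqrtOneSubFour, (summable_norm_centralBinom_mul_pow hx).of_norm.tsum_eq_zero_add]
  rw [Nat.centralBinom_zero, Nat.cast_one, pow_zero, mul_one, add_sub_cancel_left]
  refine tsum_of_norm_bounded (g := fun n : ℕ => (4 * ‖x‖) * (4 * ‖x‖) ^ n) ?_ fun n => ?_
  · exact (hasSum_geometric_of_lt_one (by positivity) (by linarith)).mul_left _
  · exact (norm_centralBinom_mul_pow_le x n.succ_ne_zero).trans_eq (pow_succ' _ _)

theorem analyticAt_invSqrtOneSubFour {x : A}
    (hx : ‖x‖ < 1 / 4) : AnalyticAt 𝕜 invSqrtOneSubFour x := by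
  set p := FormalMultilinearSeries.ofScalars A fun n : ℕ => (n.centralBinom : 𝕜)
  have hsum : (invSqrtOneSubFour : A → A) = p.sum := by
    funext y
    refine tsum_congr fun n => ?_
    rw [FormalMultilinearSeries.ofScalars_apply_eq, Nat.cast_smul_eq_nsmul, nsmul_eq_mul]
  have hradius : ((1 / 4 : NNReal) : ENNReal) ≤ p.radius := by
    refine p.le_radius_of_eventually_le 1 (eventually_atTop.2 ⟨1, fun n hn => ?_⟩)
    have hbinom : (n.centralBinom : ℝ) ≤ 4 ^ n := mod_cast n.centralBinom_le_four_pow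
    calc ‖p n‖ * ((1 / 4 : NNReal) : ℝ) ^ n ≤ n.centralBinom * (1 / 4) ^ n := by
          gcongr
          · exact (FormalMultilinearSeries.ofScalars_norm_le A _ n hn).trans_eq (by simp)
          · simp
      _ ≤ 4 ^ n * (1 / 4) ^ n := by gcongr
      _ = 1 := by rw [← mul_pow]; norm_num
  rw [hsum]
  refine (p.hasFPowerSeriesOnBall (lt_of_lt_of_le (by simp) hradius)).analyticAt_of_mem ?_
  refine Metric.eball_subset_eball hradius ?_
  rw [Metric.eball_coe, mem_ball_zero_iff]
  simpa using hx

theorem isIdempotentElem_idempotentNear (hq : ‖q - q ^ 2‖ < 1 / 4) :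
    IsIdempotentElem (idempotentNear 𝕜 q) := by
  refine isIdempotentElem_inv_two_smul_one_add ?_
  rw [(commute_two_mul_sub_one_invSqrtOneSubFour q).mul_pow,
    show (2 * q - 1) ^ 2 = 1 - 4 * (q - q ^ 2) by noncomm_ring]
  exact invSqrtOneSubFour_sq_mul hq

theorem norm_idempotentNear_sub_le (hq : ‖q - q ^ 2‖ < 1 / 4) :
    ‖idempotentNear 𝕜 q - q‖ ≤ (‖q‖ + 1 / 2) * (4 * ‖q - q ^ 2‖ / (1 - 4 * ‖q - q ^ 2‖)) := by
  set g := invSqrtOneSubFour (q - q ^ 2) with hg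
  have heq : idempotentNear 𝕜 q - q = q * (g - 1) - (2⁻¹ : 𝕜) • (g - 1) := by
    have h2q : (2⁻¹ : 𝕜) • (2 * q * g) = q * g := by
      rw [mul_assoc, two_mul, ← two_smul 𝕜, smul_smul, inv_mul_cancel₀ two_ne_zero, one_smul]
    rw [idempotentNear, ← hg, sub_mul, one_mul, smul_add, smul_sub, h2q]
    simp only [smul_sub, mul_sub, mul_one]
    abel
  calc ‖idempotentNear 𝕜 q - q‖ ≤ ‖q‖ * ‖g - 1‖ + 2⁻¹ * ‖g - 1‖ := by
        rw [heq]
        refine (norm_sub_le _ _).trans (add_le_add (norm_mul_le _ _) ?_)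
        rw [norm_smul, norm_inv, RCLike.norm_ofNat]
    _ = (‖q‖ + 1 / 2) * ‖g - 1‖ := by ring
    _ ≤ _ := by
        gcongr
        exact norm_invSqrtOneSubFour_sub_one_le hq

theorem idempotentNear_eq_self (hq : IsIdempotentElem q) : idempotentNear 𝕜 q = q := by
  have hdef : ‖q - q ^ 2‖ = 0 := by rw [sq, hq.eq, sub_self, norm_zero]
  have h := norm_idempotentNear_sub_le (𝕜 := 𝕜) (q := q) (by rw [hdef]; norm_num)
  rw [hdef, mul_zero, zero_div, mul_zero] at h
  exact sub_eq_zero.1 (norm_le_zero_iff.1 h)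

theorem analyticAt_idempotentNear (hq : ‖q - q ^ 2‖ < 1 / 4) :
    AnalyticAt 𝕜 (idempotentNear 𝕜) q := by
  have hid : AnalyticAt 𝕜 (fun x : A => x) q := analyticAt_id
  have hinv : AnalyticAt 𝕜 (fun x : A => invSqrtOneSubFour (x - x ^ 2)) q :=
    AnalyticAt.comp (g := invSqrtOneSubFour) (analyticAt_invSqrtOneSubFour hq)
      (hid.sub (hid.pow 2))
  exact (analyticAt_const.add (((analyticAt_const.mul hid).sub analyticAt_const).mul
    hinv)).fun_const_smul

theorem eventually_isIdempotentElem_idempotentNear {X : Type*} {l : Filter X} {Q : X → A}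
    (hQ : Tendsto Q l (𝓝 q)) (hq : ‖q - q ^ 2‖ < 1 / 4) :
    ∀ᶠ x in l, IsIdempotentElem (idempotentNear 𝕜 (Q x)) := by
  filter_upwards [(hQ.sub (hQ.pow 2)).norm.eventually_lt_const hq] with x hx
  exact isIdempotentElem_idempotentNear hx

theorem idempotentNear_eq_of_norm_sub_le {p : A} (hp : IsIdempotentElem p) (hpn : ‖p‖ ≤ 1)
    (hc : Commute q p) (hd : ‖q - p‖ ≤ 1 / 100) : idempotentNear 𝕜 q = p := by
  have hdef : ‖q - q ^ 2‖ ≤ 301 / 10000 := by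
    have h := norm_sub_sq_le_of_isIdempotentElem (q := q) hp hpn
    nlinarith [norm_nonneg (q - p)]
  have hqn : ‖q‖ ≤ 101 / 100 := by linarith [norm_le_norm_add_norm_sub' q p]
  refine eq_of_isIdempotentElem_of_norm_sub_lt_one (isIdempotentElem_idempotentNear
    (by linarith)) hp (commute_idempotentNear hc) ?_
  have hfrac : 4 * ‖q - q ^ 2‖ / (1 - 4 * ‖q - q ^ 2‖) ≤ 1 / 7 := by
    rw [div_le_div_iff₀ (by linarith) (by norm_num)]
    linarith
  calc ‖idempotentNear 𝕜 q - p‖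
      ≤ ‖idempotentNear 𝕜 q - q‖ + ‖q - p‖ := norm_sub_le_norm_sub_add_norm_sub _ _ _
    _ ≤ (‖q‖ + 1 / 2) * (1 / 7) + 1 / 100 := by
      gcongr
      exact (norm_idempotentNear_sub_le (by linarith)).trans (by gcongr)
    _ < 1 := by linarith

end Idempotents

section SpectralPolynomial

open Polynomial

theorem aeval_mul_of_mul_eq_smul {R A : Type*} [CommSemiring R] [Semiring A] [Algebra R A]
    {a e : A} {κ : R} (h : a * e = κ • e) (f : R[X]) : aeval a f * e = f.eval κ • e := by
  have hpow (n : ℕ) : a ^ n * e = κ ^ n • e := by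
    induction n with
    | zero => rw [pow_zero, pow_zero, one_mul, one_smul]
    | succ n ih => rw [pow_succ, mul_assoc, h, mul_smul_comm, ih, smul_smul, pow_succ']
  induction f using Polynomial.induction_on' with
  | add p q hp hq => rw [map_add, add_mul, hp, hq, eval_add, add_smul]
  | monomial n c =>
    rw [aeval_monomial, eval_monomial, mul_assoc, hpow, ← Algebra.smul_def, smul_smul]

theorem aeval_mul_eq_self {R A : Type*} [CommSemiring R] [Semiring A] [Algebra R A] {a p : A}
    (h : a * p = a) {f : R[X]} (hf : f.eval 0 = 0) : aeval a f * p = aeval a f := by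
  obtain ⟨g, rfl⟩ : X ∣ f := by rw [X_dvd_iff, ← hf, coeff_zero_eq_eval_zero]
  rw [mul_comm, map_mul, aeval_X, mul_assoc, h]

theorem eval_eq_zero_of_mem_spectrum {K A : Type*} [Field K] [Ring A] [Algebra K A] {a : A}
    {f : K[X]} (hf : aeval a f = 0) {κ : K} (hκ : κ ∈ spectrum K a) : f.eval κ = 0 := by
  have hmem := spectrum.subset_polynomial_aeval a f ⟨κ, hκ, rfl⟩
  cases subsingleton_or_nontrivial A with
  | inl _ => rw [spectrum.of_subsingleton] at hκ; exact hκ.elim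
  | inr _ => rwa [hf, spectrum.zero_eq] at hmem

theorem isSelfAdjoint_aeval {A : Type*} [CStarAlgebra A] {a : A} (ha : IsSelfAdjoint a)
    (f : ℝ[X]) : IsSelfAdjoint (aeval a f) := by
  rw [← cfc_polynomial f a ha]
  exact IsSelfAdjoint.cfc

theorem aeval_eq_aeval_of_eqOn_spectrum {A : Type*} [CStarAlgebra A] {a : A}
    (ha : IsSelfAdjoint a) {f g : ℝ[X]} (h : ∀ x ∈ spectrum ℝ a, f.eval x = g.eval x) :
    aeval a f = aeval a g := by
  rw [← cfc_polynomial f a ha, ← cfc_polynomial g a ha]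
  exact cfc_congr h

theorem exists_mem_spectrum_ne_zero {A : Type*} [CStarAlgebra A] {a : A} (ha : IsSelfAdjoint a)
    (h0 : a ≠ 0) : ∃ κ ∈ spectrum ℝ a, κ ≠ 0 := by
  by_contra! h
  refine h0 ?_
  simpa only [aeval_X, map_zero] using
    aeval_eq_aeval_of_eqOn_spectrum (f := X) (g := 0) ha (by simpa using h)

theorem exists_spectral_polynomial {A : Type*} [CStarAlgebra A] {a : A} (ha : IsSelfAdjoint a)
    (hfin : (spectrum ℝ a).Finite) {κ : ℝ} (hκ : κ ∈ spectrum ℝ a) (hκ0 : κ ≠ 0) :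
    ∃ f : ℝ[X], f.eval 0 = 0 ∧ f.eval κ = 1 ∧ aeval a f ≠ 0 ∧ IsIdempotentElem (aeval a f) ∧
      a * aeval a f = κ • aeval a f := by
  classical
  set f := Lagrange.basis (insert 0 hfin.toFinset) id κ
  have hfκ : f.eval κ = 1 := by
    simpa using Lagrange.eval_basis_self (v := id) (i := κ) Function.injective_id.injOn
      (Finset.mem_insert_of_mem (hfin.mem_toFinset.2 hκ))
  have hf0 : f.eval 0 = 0 := by
    simpa using Lagrange.eval_basis_of_ne (v := id) hκ0 (Finset.mem_insert_self _ _)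
  have hfs : ∀ x ∈ spectrum ℝ a, x ≠ κ → f.eval x = 0 := fun x hx hne => by
    simpa using Lagrange.eval_basis_of_ne (v := id) hne.symm
      (Finset.mem_insert_of_mem (hfin.mem_toFinset.2 hx))
  refine ⟨f, hf0, hfκ, fun h => ?_, ?_, ?_⟩
  · exact one_ne_zero (hfκ.symm.trans (eval_eq_zero_of_mem_spectrum h hκ))
  · rw [IsIdempotentElem, ← map_mul]
    refine aeval_eq_aeval_of_eqOn_spectrum ha fun x hx => ?_
    rcases eq_or_ne x κ with rfl | hne
    · rw [eval_mul, hfκ, mul_one]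
    · rw [eval_mul, hfs x hx hne, mul_zero]
  · have h1 : a * aeval a f = aeval a (X * f) := by rw [map_mul, aeval_X]
    have h2 : κ • aeval a f = aeval a (κ • f) := by rw [map_smul]
    rw [h1, h2]
    refine aeval_eq_aeval_of_eqOn_spectrum ha fun x hx => ?_
    rcases eq_or_ne x κ with rfl | hne
    · rw [eval_mul, eval_X, eval_smul, smul_eq_mul]
    · rw [eval_mul, eval_smul, hfs x hx hne, mul_zero, smul_zero]

theorem analyticAt_aeval_real {A : Type*} [NormedRing A] [NormedAlgebra ℂ A] {N : ℂ → A} {z₀ : ℂ}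
    (hN : AnalyticAt ℂ N z₀) (f : ℝ[X]) : AnalyticAt ℂ (fun z => aeval (N z) f) z₀ := by
  simpa only [aeval_map_algebraMap] using hN.aeval_polynomial (f.map (algebraMap ℝ ℂ))

end SpectralPolynomial

section FiniteRank

open Polynomial Module

theorem aeval_comp_eq_comp_aeval {R M M' : Type*} [CommSemiring R] [AddCommMonoid M] [Module R M]
    [AddCommMonoid M'] [Module R M'] {a : End R M} {b : End R M'} {φ : M →ₗ[R] M'}
    (h : b ∘ₗ φ = φ ∘ₗ a) (f : R[X]) : aeval b f ∘ₗ φ = φ ∘ₗ aeval a f := by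
  induction f using Polynomial.induction_on' with
  | add p q hp hq => rw [map_add, map_add, LinearMap.add_comp, LinearMap.comp_add, hp, hq]
  | monomial n c =>
    ext x
    simpa using congrArg (c • ·) (LinearMap.congr_fun
      (Module.End.commute_pow_left_of_commute h n) x)

theorem isAlgebraic_of_finiteDimensional_range {K V : Type*} [Field K] [AddCommGroup V] [Module K V]
    (a : End K V) [FiniteDimensional K a.range] : IsAlgebraic K a := by
  set b : End K a.range := a.rangeRestrict ∘ₗ a.range.subtype
  refine ⟨X * b.charpoly, mul_ne_zero X_ne_zero b.charpoly_monic.ne_zero, ?_⟩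
  have hker : a.rangeRestrict ∘ₗ aeval a b.charpoly = 0 := by
    rw [← aeval_comp_eq_comp_aeval (a := a) (b := b) (φ := a.rangeRestrict) rfl,
      b.aeval_self_charpoly, LinearMap.zero_comp]
  rw [map_mul, aeval_X, Module.End.mul_eq_comp]
  ext x
  exact congrArg Subtype.val (LinearMap.congr_fun hker x)

theorem finite_spectrum_of_isAlgebraic {K A : Type*} [Field K] [Ring A] [Algebra K A] {a : A}
    (h : IsAlgebraic K a) : (spectrum K a).Finite := by
  obtain ⟨f, hf, ha⟩ := h
  exact (f.finite_setOfPred_isRoot hf).subset fun x hx => eval_eq_zero_of_mem_spectrum ha hx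

variable {𝕜 E : Type*} [NontriviallyNormedField 𝕜] [NormedAddCommGroup E] [NormedSpace 𝕜 E]
  {p q : E →L[𝕜] E}

theorem finite_spectrum_of_finiteDimensional_range (a : E →L[𝕜] E) [FiniteDimensional 𝕜 a.range] :
    (spectrum 𝕜 a).Finite := by
  set φ : (E →L[𝕜] E) →ₐ[𝕜] End 𝕜 E :=
    ⟨ContinuousLinearMap.toLinearMapRingHom, fun _ => rfl⟩
  exact finite_spectrum_of_isAlgebraic
    ((isAlgebraic_algHom_iff φ ContinuousLinearMap.coe_injective).1
      (isAlgebraic_of_finiteDimensional_range (a : E →ₗ[𝕜] E)))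

theorem mem_range_iff_apply_eq_self (hp : IsIdempotentElem p) {x : E} : x ∈ p.range ↔ p x = x :=
  LinearMap.IsIdempotentElem.mem_range_iff
    (ContinuousLinearMap.isIdempotentElem_toLinearMap_iff.2 hp)

theorem range_le_range_of_mul_eq (h : p * q = q) : q.range ≤ p.range := by
  rintro _ ⟨x, rfl⟩
  exact ⟨q x, DFunLike.congr_fun h x⟩

theorem finrank_range_lt_of_ne (hq : IsIdempotentElem q) (hpq : p * q = q) (hqp : q * p = q)
    (hne : q ≠ p) [FiniteDimensional 𝕜 p.range] : finrank 𝕜 q.range < finrank 𝕜 p.range := by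
  refine Submodule.finrank_lt_finrank_of_lt
    ((range_le_range_of_mul_eq hpq).lt_of_ne fun he => hne ?_)
  ext x
  have hx : p x ∈ q.range := he ▸ LinearMap.mem_range_self _ x
  rw [← (mem_range_iff_apply_eq_self hq).1 hx]
  exact (DFunLike.congr_fun hqp x).symm

theorem disjoint_range_ker_of_norm_sub_lt_one (hp : IsIdempotentElem p) (h : ‖p - q‖ < 1) :
    Disjoint p.range q.ker := by
  rw [Submodule.disjoint_def]
  intro x hx hqx
  have hle := (p - q).le_opNorm x
  rw [sub_apply, (mem_range_iff_apply_eq_self hp).1 hx,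
    show q x = 0 from hqx, sub_zero] at hle
  exact norm_le_zero_iff.1 (by nlinarith [norm_nonneg x])

theorem injective_restrict_range_of_norm_sub_lt_one (hp : IsIdempotentElem p) (h : ‖p - q‖ < 1) :
    Function.Injective ((q : E →ₗ[𝕜] E).restrict (p := p.range) (q := q.range)
      fun x _ => LinearMap.mem_range_self _ x) := by
  refine LinearMap.ker_eq_bot.1 (LinearMap.ker_eq_bot'.2 fun x hx => Subtype.ext ?_)
  exact Submodule.disjoint_def.1 (disjoint_range_ker_of_norm_sub_lt_one hp h) x x.2
    (congrArg Subtype.val hx)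

theorem finrank_range_eq_of_norm_sub_lt_one (hp : IsIdempotentElem p) (hq : IsIdempotentElem q)
    (h : ‖p - q‖ < 1) [FiniteDimensional 𝕜 p.range] :
    FiniteDimensional 𝕜 q.range ∧ finrank 𝕜 q.range = finrank 𝕜 p.range := by
  have hpq := injective_restrict_range_of_norm_sub_lt_one hp h
  have hqp := injective_restrict_range_of_norm_sub_lt_one hq (norm_sub_rev p q ▸ h)
  have : FiniteDimensional 𝕜 q.range := .of_injective _ hqp
  exact ⟨this, le_antisymm (LinearMap.finrank_le_finrank_of_injective hqp)
    (LinearMap.finrank_le_finrank_of_injective hpq)⟩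

end FiniteRank

section Diagonalization

variable {𝕜 A ι κ : Type*} [NontriviallyNormedField 𝕜] [NormedRing A] [NormedAlgebra 𝕜 A]
  [Fintype ι] [Fintype κ] {M N P Q : 𝕜 → A} {z₀ : 𝕜}
  {s : ι → 𝕜 → 𝕜} {p : ι → 𝕜 → A} {t : κ → 𝕜 → 𝕜} {q : κ → 𝕜 → A}

/-- Near `z₀`, the `p j` decompose `P` analytically into orthogonal idempotents on which `M` acts
as the analytic scalars `s j`; these eigenvalues may coincide only at `z₀` itself. -/
structure IsDiagonalizationAt (M P : 𝕜 → A) (z₀ : 𝕜) (s : ι → 𝕜 → 𝕜) (p : ι → 𝕜 → A) : Prop where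
  analyticAt_eigenvalue : ∀ j, AnalyticAt 𝕜 (s j) z₀
  analyticAt_proj : ∀ j, AnalyticAt 𝕜 (p j) z₀
  ne_zero : ∀ j, p j z₀ ≠ 0
  orthogonal : ∀ᶠ z in 𝓝 z₀, OrthogonalIdempotents (p · z)
  sum_eq : ∀ᶠ z in 𝓝 z₀, ∑ j, p j z = P z
  mul_proj : ∀ᶠ z in 𝓝 z₀, ∀ j, M z * p j z = s j z • p j z
  proj_mul : ∀ᶠ z in 𝓝 z₀, ∀ j, p j z * M z = s j z • p j z
  injective : ∀ᶠ z in 𝓝[≠] z₀, Function.Injective (s · z)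

namespace IsDiagonalizationAt

theorem of_isEmpty [IsEmpty ι] (hP : ∀ᶠ z in 𝓝 z₀, P z = 0) : IsDiagonalizationAt M P z₀ s p where
  analyticAt_eigenvalue := isEmptyElim
  analyticAt_proj := isEmptyElim
  ne_zero := isEmptyElim
  orthogonal := .of_forall fun _ => ⟨isEmptyElim, fun i => isEmptyElim i⟩
  sum_eq := hP.mono fun z h => by rw [h, Finset.univ_eq_empty, Finset.sum_empty]
  mul_proj := .of_forall fun _ => isEmptyElim
  proj_mul := .of_forall fun _ => isEmptyElim
  injective := .of_forall fun _ i => isEmptyElim i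

theorem of_unique [Unique ι] {τ : 𝕜 → 𝕜} (hτ : AnalyticAt 𝕜 τ z₀) (hP : AnalyticAt 𝕜 P z₀)
    (hP0 : P z₀ ≠ 0) (hidem : ∀ᶠ z in 𝓝 z₀, IsIdempotentElem (P z))
    (hMP : ∀ᶠ z in 𝓝 z₀, M z * P z = τ z • P z) (hPM : ∀ᶠ z in 𝓝 z₀, P z * M z = τ z • P z) :
    IsDiagonalizationAt M P z₀ (fun _ : ι => τ) (fun _ => P) where
  analyticAt_eigenvalue _ := hτ
  analyticAt_proj _ := hP
  ne_zero _ := hP0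
  orthogonal := hidem.mono fun _ h => ⟨fun _ => h, Subsingleton.pairwise⟩
  sum_eq := .of_forall fun _ => by rw [Fintype.sum_unique]
  mul_proj := hMP.mono fun _ h _ => h
  proj_mul := hPM.mono fun _ h _ => h
  injective := .of_forall fun _ => Function.injective_of_subsingleton _

theorem proj_mul_eq (h : IsDiagonalizationAt M P z₀ s p) :
    ∀ᶠ z in 𝓝 z₀, ∀ j, p j z * P z = p j z := by
  filter_upwards [h.orthogonal, h.sum_eq] with z ho hs j
  rw [← hs, ho.mul_sum_of_mem (Finset.mem_univ j)]

theorem mul_proj_eq (h : IsDiagonalizationAt M P z₀ s p) :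
    ∀ᶠ z in 𝓝 z₀, ∀ j, P z * p j z = p j z := by
  classical
  filter_upwards [h.orthogonal, h.sum_eq] with z ho hs j
  rw [← hs, Finset.sum_mul]
  simp only [ho.mul_eq, Finset.sum_ite_eq', Finset.mem_univ, if_true]

theorem eigenvalue_eq_of_mul_eq_smul (h : IsDiagonalizationAt M P z₀ s p) {c : 𝕜}
    (hc : M z₀ * P z₀ = c • P z₀) (j : ι) : s j z₀ = c := by
  have hP := h.mul_proj_eq.self_of_nhds j
  have hM := h.mul_proj.self_of_nhds j
  rw [← hP, ← mul_assoc, hc, smul_mul_assoc, hP] at hM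
  exact (smul_left_injective 𝕜 (h.ne_zero j) hM).symm

theorem eigenvalue_ne (h : IsDiagonalizationAt M P z₀ s p) {c : 𝕜}
    (hc : ∀ e, M z₀ * e = c • e → P z₀ * e = 0) (j : ι) : s j z₀ ≠ c := by
  rintro rfl
  have hzero := hc _ (h.mul_proj.self_of_nhds j)
  rw [h.mul_proj_eq.self_of_nhds j] at hzero
  exact h.ne_zero j hzero

theorem of_sub_smul_eq_pow_smul {τ : 𝕜 → 𝕜} {k : ℕ} (h : IsDiagonalizationAt N P z₀ s p)
    (hτ : AnalyticAt 𝕜 τ z₀) (hc : ∀ᶠ z in 𝓝 z₀, Commute (P z) (M z))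
    (hM : ∀ᶠ z in 𝓝 z₀, M z * P z - τ z • P z = (z - z₀) ^ k • N z) :
    IsDiagonalizationAt M P z₀ (fun j z => τ z + (z - z₀) ^ k * s j z) p where
  analyticAt_eigenvalue j :=
    hτ.add (((analyticAt_id.sub analyticAt_const).pow k).mul (h.analyticAt_eigenvalue j))
  analyticAt_proj := h.analyticAt_proj
  ne_zero := h.ne_zero
  orthogonal := h.orthogonal
  sum_eq := h.sum_eq
  mul_proj := by
    filter_upwards [h.mul_proj, h.mul_proj_eq, hM] with z hN hP hM j
    calc M z * p j z = (M z * P z) * p j z := by rw [mul_assoc, hP]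
      _ = _ := by rw [sub_eq_iff_eq_add'.1 hM, add_mul, smul_mul_assoc, smul_mul_assoc, hN, hP,
        add_smul, mul_smul]
  proj_mul := by
    filter_upwards [h.proj_mul, h.proj_mul_eq, hM, hc] with z hN hP hM hc j
    calc p j z * M z = p j z * (M z * P z) := by rw [← hc.eq, ← mul_assoc, hP]
      _ = _ := by rw [sub_eq_iff_eq_add'.1 hM, mul_add, mul_smul_comm, mul_smul_comm, hN, hP,
        add_smul, mul_smul]
  injective := by
    filter_upwards [h.injective, self_mem_nhdsWithin] with z hinj hz
    exact (add_right_injective _).comp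
      ((mul_right_injective₀ (pow_ne_zero k (sub_ne_zero.2 hz))).comp hinj)

theorem sumElim (h : IsDiagonalizationAt M P z₀ s p) (h' : IsDiagonalizationAt M Q z₀ t q)
    (hPQ : ∀ᶠ z in 𝓝 z₀, P z * Q z = 0) (hQP : ∀ᶠ z in 𝓝 z₀, Q z * P z = 0)
    (hne : ∀ i j, s i z₀ ≠ t j z₀) :
    IsDiagonalizationAt M (fun z => P z + Q z) z₀ (Sum.elim s t) (Sum.elim p q) where
  analyticAt_eigenvalue := Sum.rec h.analyticAt_eigenvalue h'.analyticAt_eigenvalue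
  analyticAt_proj := Sum.rec h.analyticAt_proj h'.analyticAt_proj
  ne_zero := Sum.rec h.ne_zero h'.ne_zero
  orthogonal := by
    filter_upwards [h.orthogonal, h'.orthogonal, h.mul_proj_eq, h.proj_mul_eq, h'.mul_proj_eq,
      h'.proj_mul_eq, hPQ, hQP] with z ho ho' hPp hpP hQq hqQ hPQ hQP
    refine ⟨Sum.rec ho.idem ho'.idem, ?_⟩
    rintro (i | i) (j | j) hij
    · exact ho.ortho fun hi => hij (congrArg _ hi)
    · calc p i z * q j z = p i z * (P z * Q z) * q j z := by
            rw [← mul_assoc, hpP, mul_assoc, hQq]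
        _ = 0 := by rw [hPQ, mul_zero, zero_mul]
    · calc q i z * p j z = q i z * (Q z * P z) * p j z := by
            rw [← mul_assoc, hqQ, mul_assoc, hPp]
        _ = 0 := by rw [hQP, mul_zero, zero_mul]
    · exact ho'.ortho fun hi => hij (congrArg _ hi)
  sum_eq := by
    filter_upwards [h.sum_eq, h'.sum_eq] with z hs hs'
    simp only [Fintype.sum_sum_type, Sum.elim_inl, Sum.elim_inr, hs, hs']
  mul_proj := by
    filter_upwards [h.mul_proj, h'.mul_proj] with z hp hq using Sum.rec hp hq
  proj_mul := by
    filter_upwards [h.proj_mul, h'.proj_mul] with z hp hq using Sum.rec hp hq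
  injective := by
    have hst : ∀ᶠ z in 𝓝 z₀, ∀ i j, s i z ≠ t j z :=
      eventually_all.2 fun i => eventually_all.2 fun j =>
        ((h.analyticAt_eigenvalue i).continuousAt.ne_iff_eventually_ne
          (h'.analyticAt_eigenvalue j).continuousAt).1 (hne i j)
    filter_upwards [h.injective, h'.injective, hst.filter_mono nhdsWithin_le_nhds] with z hs ht hst
    have helim : (Sum.elim s t · z) = Sum.elim (s · z) (t · z) := by
      ext (i | j) <;> rfl
    rw [helim]
    exact hs.sumElim ht hst

end IsDiagonalizationAt

end Diagonalization

section Reduction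

theorem tendsto_ofReal_nhdsNE (x₀ : ℝ) :
    Tendsto ((↑) : ℝ → ℂ) (𝓝[≠] x₀) (𝓝[≠] (x₀ : ℂ)) :=
  Complex.continuous_ofReal.continuousAt.tendsto.inf <| tendsto_principal_principal.2
    fun _ hx h => hx (Complex.ofReal_injective h)

theorem eventually_ofReal {x₀ : ℝ} {p : ℂ → Prop} (h : ∀ᶠ z in 𝓝 (x₀ : ℂ), p z) :
    ∀ᶠ x : ℝ in 𝓝 x₀, p x :=
  Complex.continuous_ofReal.continuousAt.eventually h

theorem eventually_eq_of_smul_eq {X 𝕜 E : Type*} [TopologicalSpace X] {a : X} [(𝓝[≠] a).NeBot]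
    [DivisionRing 𝕜] [AddCommGroup E] [TopologicalSpace E] [T2Space E] [Module 𝕜 E]
    {c : X → 𝕜} {f g : X → E} (hc : ∀ᶠ x in 𝓝[≠] a, c x ≠ 0) (hf : ContinuousAt f a)
    (hg : ContinuousAt g a) (h : ∀ᶠ x in 𝓝 a, c x • f x = c x • g x) :
    ∀ᶠ x in 𝓝 a, f x = g x := by
  refine (hf.eventuallyEq_nhds_iff_eventuallyEq_nhdsNE hg).1 ?_
  filter_upwards [hc, h.filter_mono nhdsWithin_le_nhds] with x hcx hx
  exact smul_right_injective E hcx hx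

theorem eventually_sub_pow_ne_zero {𝕜 : Type*} [NormedField 𝕜] (z₀ : 𝕜) (k : ℕ) :
    ∀ᶠ z in 𝓝[≠] z₀, (z - z₀) ^ k ≠ 0 :=
  eventually_nhdsWithin_of_forall fun _ hz => pow_ne_zero k (sub_ne_zero.2 hz)

section Algebra

variable {A : Type*} [NormedRing A] [StarRing A] [NormedAlgebra ℂ A] {M N G P P' : ℂ → A} {x₀ : ℝ}

/-- Near the real point `x₀`, the family `M` is analytic and self-adjoint on the real axis, and it
is reduced by (commutes with) the analytic family of projections `P`, also self-adjoint on the real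
axis. -/
structure IsReducedFamilyAt (M P : ℂ → A) (x₀ : ℝ) : Prop where
  analyticAt : AnalyticAt ℂ M x₀
  analyticAt_proj : AnalyticAt ℂ P x₀
  isIdempotentElem : ∀ᶠ z in 𝓝 (x₀ : ℂ), IsIdempotentElem (P z)
  commute : ∀ᶠ z in 𝓝 (x₀ : ℂ), Commute (P z) (M z)
  isSelfAdjoint : ∀ᶠ x : ℝ in 𝓝 x₀, IsSelfAdjoint (M x)
  isSelfAdjoint_proj : ∀ᶠ x : ℝ in 𝓝 x₀, IsSelfAdjoint (P x)

namespace IsReducedFamilyAt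

theorem sub_proj (h : IsReducedFamilyAt M P x₀) (h' : IsReducedFamilyAt M P' x₀)
    (hP'P : ∀ᶠ z in 𝓝 (x₀ : ℂ), P' z * P z = P' z) (hPP' : ∀ᶠ z in 𝓝 (x₀ : ℂ), P z * P' z = P' z) :
    IsReducedFamilyAt M (fun z => P z - P' z) x₀ where
  analyticAt := h.analyticAt
  analyticAt_proj := h.analyticAt_proj.sub h'.analyticAt_proj
  isIdempotentElem := by
    filter_upwards [h.isIdempotentElem, h'.isIdempotentElem, hP'P, hPP'] with z hP hP' h1 h2
    exact hP'.sub hP h1 h2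
  commute := by
    filter_upwards [h.commute, h'.commute] with z hP hP' using hP.sub_left hP'
  isSelfAdjoint := h.isSelfAdjoint
  isSelfAdjoint_proj := by
    filter_upwards [h.isSelfAdjoint_proj, h'.isSelfAdjoint_proj] with x hP hP' using hP.sub hP'

theorem isSelfAdjoint_mul (h : IsReducedFamilyAt M P x₀) :
    ∀ᶠ x : ℝ in 𝓝 x₀, IsSelfAdjoint (M x * P x) := by
  filter_upwards [h.isSelfAdjoint, h.isSelfAdjoint_proj, eventually_ofReal h.commute]
    with x hM hP hc
  exact (hM.commute_iff hP).1 hc.symm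

theorem mul_sub_smul [StarModule ℂ A] (h : IsReducedFamilyAt M P x₀) {τ : ℂ → ℂ}
    (hτ : AnalyticAt ℂ τ x₀) (hτr : ∀ᶠ x : ℝ in 𝓝 x₀, IsSelfAdjoint (τ x)) :
    IsReducedFamilyAt (fun z => M z * P z - τ z • P z) P x₀ where
  analyticAt := (h.analyticAt.mul h.analyticAt_proj).sub (hτ.smul h.analyticAt_proj)
  analyticAt_proj := h.analyticAt_proj
  isIdempotentElem := h.isIdempotentElem
  commute := h.commute.mono fun z hc =>
    (hc.mul_right (Commute.refl _)).sub_right ((Commute.refl _).smul_right _)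
  isSelfAdjoint := by
    filter_upwards [h.isSelfAdjoint_mul, h.isSelfAdjoint_proj, hτr] with x hMP hP hτ
    exact hMP.sub (hτ.smul hP)
  isSelfAdjoint_proj := h.isSelfAdjoint_proj

theorem of_pow_smul [ContinuousStar A] [StarModule ℂ A] (h : IsReducedFamilyAt G P x₀) {k : ℕ}
    (hN : AnalyticAt ℂ N x₀) (hGN : ∀ᶠ z in 𝓝 (x₀ : ℂ), G z = (z - x₀) ^ k • N z) :
    IsReducedFamilyAt N P x₀ where
  analyticAt := hN
  analyticAt_proj := h.analyticAt_proj
  isIdempotentElem := h.isIdempotentElem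
  commute := by
    have hP := h.analyticAt_proj.continuousAt
    refine eventually_eq_of_smul_eq (eventually_sub_pow_ne_zero _ k) (hP.mul hN.continuousAt)
      (hN.continuousAt.mul hP) ?_
    filter_upwards [h.commute, hGN] with z hc hz
    rw [← mul_smul_comm, ← smul_mul_assoc, ← hz, hc.eq]
  isSelfAdjoint := by
    have hNr : ContinuousAt (fun x : ℝ => N x) x₀ :=
      ContinuousAt.comp (g := N) hN.continuousAt Complex.continuous_ofReal.continuousAt
    refine eventually_eq_of_smul_eq ((tendsto_ofReal_nhdsNE x₀).eventually
      (eventually_sub_pow_ne_zero _ k)) hNr.star hNr ?_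
    filter_upwards [h.isSelfAdjoint, eventually_ofReal hGN] with x hs hx
    have hreal : star (((x : ℂ) - x₀) ^ k) = ((x : ℂ) - x₀) ^ k := by simp
    rw [← hx, ← hs.star_eq, hx, star_smul, hreal]
  isSelfAdjoint_proj := h.isSelfAdjoint_proj

theorem eventually_mul_proj_eq_of_pow_smul (h : IsReducedFamilyAt N P x₀) {k : ℕ}
    (hGP : ∀ᶠ z in 𝓝 (x₀ : ℂ), G z * P z = G z)
    (hGN : ∀ᶠ z in 𝓝 (x₀ : ℂ), G z = (z - x₀) ^ k • N z) :
    ∀ᶠ z in 𝓝 (x₀ : ℂ), N z * P z = N z := by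
  have hN := h.analyticAt.continuousAt
  refine eventually_eq_of_smul_eq (eventually_sub_pow_ne_zero _ k)
    (hN.mul h.analyticAt_proj.continuousAt) hN ?_
  filter_upwards [hGP, hGN] with z hP hz
  rw [← smul_mul_assoc, ← hz, hP]

end IsReducedFamilyAt

end Algebra

theorem eventually_mul_eq_of_isIdempotentElem {X A : Type*} [TopologicalSpace X] [NormedRing A]
    {p q : X → A} {a : X} (hpc : ContinuousAt p a) (hqc : ContinuousAt q a)
    (hp : ∀ᶠ x in 𝓝 a, IsIdempotentElem (p x)) (hq : ∀ᶠ x in 𝓝 a, IsIdempotentElem (q x))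
    (hc : ∀ᶠ x in 𝓝 a, Commute (p x) (q x)) (h : p a * q a = p a) :
    ∀ᶠ x in 𝓝 a, p x * q x = p x := by
  have hlt : ∀ᶠ x in 𝓝 a, ‖p x * (1 - q x)‖ < 1 := by
    have hzero : ‖p a * (1 - q a)‖ < 1 := by
      rw [mul_one_sub, h, sub_self, norm_zero]
      exact one_pos
    exact (hpc.mul (continuousAt_const.sub hqc)).norm.eventually_lt_const hzero
  filter_upwards [hp, hq, hc, hlt] with x hp hq hc hlt
  have hidem : IsIdempotentElem (p x * (1 - q x)) :=
    .mul_of_commute ((Commute.one_right _).sub_right hc) hp hq.one_sub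
  have hzero := eq_zero_of_isIdempotentElem_of_norm_lt_one hidem hlt
  rw [mul_one_sub, sub_eq_zero] at hzero
  exact hzero.symm

theorem commute_aeval {R A : Type*} [CommSemiring R] [Semiring A] [Algebra R A] {a b : A}
    (h : Commute a b) (f : Polynomial R) : Commute (Polynomial.aeval a f) b :=
  (Algebra.commute_of_mem_adjoin_singleton_of_commute (Polynomial.aeval_mem_adjoin_singleton R a)
    h.symm).symm

theorem IsReducedFamilyAt.exists_subprojection {A : Type*} [CStarAlgebra A] {N P : ℂ → A} {x₀ : ℝ}
    (h : IsReducedFamilyAt N P x₀) (hNP : ∀ᶠ z in 𝓝 (x₀ : ℂ), N z * P z = N z) (hN0 : N x₀ ≠ 0)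
    (hfin : (spectrum ℝ (N x₀)).Finite) :
    ∃ (P' : ℂ → A) (κ : ℝ), κ ≠ 0 ∧ IsReducedFamilyAt N P' x₀ ∧
      (∀ᶠ z in 𝓝 (x₀ : ℂ), P' z * P z = P' z) ∧ (∀ᶠ z in 𝓝 (x₀ : ℂ), P z * P' z = P' z) ∧
      P' x₀ ≠ 0 ∧ N x₀ * P' x₀ = (κ : ℂ) • P' x₀ ∧ ∀ e, N x₀ * e = (κ : ℂ) • e → P' x₀ * e = e := by
  have hs₀ : IsSelfAdjoint (N x₀) := h.isSelfAdjoint.self_of_nhds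
  obtain ⟨κ, hκs, hκ⟩ := exists_mem_spectrum_ne_zero hs₀ hN0
  obtain ⟨f, hf0, hfκ, hne, hidem, hmul⟩ := exists_spectral_polynomial hs₀ hfin hκs hκ
  have hfN : AnalyticAt ℂ (fun z => Polynomial.aeval (N z) f) x₀ :=
    analyticAt_aeval_real h.analyticAt f
  have hsq : ‖Polynomial.aeval (N x₀) f - Polynomial.aeval (N x₀) f ^ 2‖ < 1 / 4 := by
    rw [sq, hidem.eq, sub_self, norm_zero]
    norm_num
  set P' : ℂ → A := fun z => idempotentNear ℂ (Polynomial.aeval (N z) f)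
  have hP'₀ : P' x₀ = Polynomial.aeval (N x₀) f := idempotentNear_eq_self hidem
  have hP' : IsReducedFamilyAt N P' x₀ :=
    { analyticAt := h.analyticAt
      analyticAt_proj := AnalyticAt.comp (g := idempotentNear ℂ) (analyticAt_idempotentNear hsq) hfN
      isIdempotentElem := eventually_isIdempotentElem_idempotentNear hfN.continuousAt hsq
      commute := .of_forall fun z => commute_idempotentNear
        (commute_aeval (.refl (N z)) f)
      isSelfAdjoint := h.isSelfAdjoint
      isSelfAdjoint_proj := h.isSelfAdjoint.mono fun x hx =>
        isSelfAdjoint_idempotentNear (isSelfAdjoint_aeval hx f) }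
  have hcomm : ∀ᶠ z in 𝓝 (x₀ : ℂ), Commute (P' z) (P z) := h.commute.mono fun z hz =>
    commute_idempotentNear (commute_aeval hz.symm f)
  have hP'P : ∀ᶠ z in 𝓝 (x₀ : ℂ), P' z * P z = P' z :=
    eventually_mul_eq_of_isIdempotentElem hP'.analyticAt_proj.continuousAt
      h.analyticAt_proj.continuousAt hP'.isIdempotentElem h.isIdempotentElem hcomm
      (by rw [hP'₀, aeval_mul_eq_self hNP.self_of_nhds hf0])
  refine ⟨P', κ, hκ, hP', hP'P, ?_, by rwa [hP'₀], by rwa [hP'₀, Complex.coe_smul],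
    fun e he => ?_⟩
  · filter_upwards [hcomm, hP'P] with z hc hz
    rw [← hc.eq, hz]
  · rw [Complex.coe_smul] at he
    rw [hP'₀, aeval_mul_of_mul_eq_smul he, hfκ, one_smul]

theorem IsDiagonalizationAt.sumElim_sub_proj {𝕜 A ι κ : Type*} [NontriviallyNormedField 𝕜]
    [NormedRing A] [NormedAlgebra 𝕜 A] [Fintype ι] [Fintype κ] {N P P' : 𝕜 → A} {z₀ : 𝕜}
    {s : ι → 𝕜 → 𝕜} {p : ι → 𝕜 → A} {t : κ → 𝕜 → 𝕜} {q : κ → 𝕜 → A} {c : 𝕜}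
    (h : IsDiagonalizationAt N P' z₀ s p)
    (h' : IsDiagonalizationAt N (fun z => P z - P' z) z₀ t q)
    (hP' : ∀ᶠ z in 𝓝 z₀, IsIdempotentElem (P' z)) (hP'P : ∀ᶠ z in 𝓝 z₀, P' z * P z = P' z)
    (hPP' : ∀ᶠ z in 𝓝 z₀, P z * P' z = P' z) (hc : N z₀ * P' z₀ = c • P' z₀)
    (hmax : ∀ e, N z₀ * e = c • e → P' z₀ * e = e) :
    IsDiagonalizationAt N P z₀ (Sum.elim s t) (Sum.elim p q) := by
  have hsum := h.sumElim h' (Q := fun z => P z - P' z)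
    (by filter_upwards [hP', hP'P] with z hi hz; rw [mul_sub, hz, hi.eq, sub_self])
    (by filter_upwards [hP', hPP'] with z hi hz; rw [sub_mul, hz, hi.eq, sub_self])
    fun i j => by
      rw [h.eigenvalue_eq_of_mul_eq_smul hc i]
      refine (h'.eigenvalue_ne (fun e he => ?_) j).symm
      rw [sub_mul, ← hmax e he, ← mul_assoc, ← mul_assoc, hPP'.self_of_nhds,
        hP'.self_of_nhds.eq, sub_self]
  simpa only [add_sub_cancel] using hsum

section Operators

open scoped InnerProductSpace

variable {H : Type*} [NormedAddCommGroup H] [InnerProductSpace ℂ H]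

theorem inner_apply_ne_zero_of_mul_eq_smul {a p : H →L[ℂ] H} {c : ℂ} (hap : a * p = c • p)
    (hc : c ≠ 0) {v : H} (hv : p v = v) (hv0 : v ≠ 0) : ⟪v, a v⟫_ℂ ≠ 0 := by
  have hav : a v = c • v := by
    simpa only [mul_apply_eq_comp, smul_apply, hv] using DFunLike.congr_fun hap v
  rw [hav, inner_smul_right]
  exact mul_ne_zero hc (inner_self_ne_zero.2 hv0)

theorem analyticAt_inner_apply {F : ℂ → H →L[ℂ] H} {z₀ : ℂ} (hF : AnalyticAt ℂ F z₀) (u v : H) :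
    AnalyticAt ℂ (fun z => ⟪u, F z v⟫_ℂ) z₀ :=
  (((innerSL ℂ u).comp (ContinuousLinearMap.apply ℂ H v)).analyticAt _).comp hF

variable [CompleteSpace H] {M N P : ℂ → H →L[ℂ] H} {x₀ : ℝ}

theorem isSelfAdjoint_inner_apply_self {a : H →L[ℂ] H} (ha : IsSelfAdjoint a) (v : H) :
    IsSelfAdjoint ⟪v, a v⟫_ℂ := by
  have hsymm : ⟪a v, v⟫_ℂ = ⟪v, a v⟫_ℂ := ha.isSymmetric v v
  rw [isSelfAdjoint_iff, ← hsymm]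
  exact (inner_conj_symm _ _).trans hsymm.symm

namespace IsReducedFamilyAt

theorem finite_spectrum (h : IsReducedFamilyAt N P x₀) [FiniteDimensional ℂ (P x₀).range]
    (hNP : ∀ᶠ z in 𝓝 (x₀ : ℂ), N z * P z = N z) : (spectrum ℝ (N x₀)).Finite := by
  have hPN : P x₀ * N x₀ = N x₀ := by rw [h.commute.self_of_nhds.eq, hNP.self_of_nhds]
  have : FiniteDimensional ℂ (N x₀).range :=
    Submodule.finiteDimensional_of_le (range_le_range_of_mul_eq hPN)
  rw [← spectrum.preimage_algebraMap ℂ]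
  exact (finite_spectrum_of_finiteDimensional_range (N x₀)).preimage
    (algebraMap ℝ ℂ).injective.injOn

theorem exists_scalar_part (h : IsReducedFamilyAt M P x₀) {v : H} (hv : P x₀ v = v)
    (hv0 : v ≠ 0) :
    ∃ τ : ℂ → ℂ, AnalyticAt ℂ τ x₀ ∧ (∀ᶠ x : ℝ in 𝓝 x₀, IsSelfAdjoint (τ x)) ∧
      ∀ᶠ z in 𝓝 (x₀ : ℂ), ⟪v, (M z * P z - τ z • P z) v⟫_ℂ = 0 := by
  have hvv : ⟪v, P x₀ v⟫_ℂ ≠ 0 := by rwa [hv, inner_self_ne_zero]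
  have hP := analyticAt_inner_apply h.analyticAt_proj v v
  have hMP := analyticAt_inner_apply (h.analyticAt.mul h.analyticAt_proj) v v
  refine ⟨fun z => ⟪v, (M z * P z) v⟫_ℂ / ⟪v, P z v⟫_ℂ, hMP.div hP hvv, ?_, ?_⟩
  · filter_upwards [h.isSelfAdjoint_mul, h.isSelfAdjoint_proj] with x hMPs hPs
    exact (isSelfAdjoint_inner_apply_self hMPs v).div (isSelfAdjoint_inner_apply_self hPs v)
  · filter_upwards [hP.continuousAt.eventually_ne hvv] with z hz
    rw [sub_apply, smul_apply, inner_sub_right, inner_smul_right, div_mul_cancel₀ _ hz, sub_self]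

/-- The scalar part `τ` is chosen so that `⟪v, N x₀ v⟫ = 0`: hence `N x₀` is not a scalar on the
range of `P x₀`, and splitting its spectrum lowers the rank. -/
theorem eventually_scalar_or_exists_reduction (h : IsReducedFamilyAt M P x₀) {v : H}
    (hv : P x₀ v = v) (hv0 : v ≠ 0) :
    ∃ τ : ℂ → ℂ, AnalyticAt ℂ τ x₀ ∧ ((∀ᶠ z in 𝓝 (x₀ : ℂ), M z * P z = τ z • P z) ∨
      ∃ (k : ℕ) (N : ℂ → H →L[ℂ] H), IsReducedFamilyAt N P x₀ ∧ N x₀ ≠ 0 ∧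
        (∀ᶠ z in 𝓝 (x₀ : ℂ), N z * P z = N z) ∧ ⟪v, N x₀ v⟫_ℂ = 0 ∧
        ∀ᶠ z in 𝓝 (x₀ : ℂ), M z * P z - τ z • P z = (z - x₀) ^ k • N z) := by
  obtain ⟨τ, hτ, hτr, hvτ⟩ := h.exists_scalar_part hv hv0
  have hG := h.mul_sub_smul hτ hτr
  refine ⟨τ, hτ, or_iff_not_imp_left.2 fun hns => ?_⟩
  obtain ⟨k, N, hN, hN0, hGN⟩ := hG.analyticAt.exists_eventuallyEq_pow_smul_nonzero_iff.2
    fun h0 => hns (h0.mono fun _ => sub_eq_zero.1)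
  have hNP := hG.of_pow_smul hN hGN
  refine ⟨k, N, hNP, hN0, hNP.eventually_mul_proj_eq_of_pow_smul ?_ hGN, ?_, hGN⟩
  · filter_upwards [h.isIdempotentElem] with z hP
    rw [sub_mul, smul_mul_assoc, mul_assoc, hP.eq]
  · refine (eventually_eq_of_smul_eq (g := fun _ => (0 : ℂ)) (eventually_sub_pow_ne_zero _ k)
      (analyticAt_inner_apply hN v v).continuousAt continuousAt_const ?_).self_of_nhds
    filter_upwards [hvτ, hGN] with z hz hz'
    rw [smul_zero, smul_eq_mul, ← inner_smul_right, ← smul_apply, ← hz', hz]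

/-- Rellich's theorem; the induction on the rank is Kato's reduction process. -/
theorem exists_isDiagonalizationAt (h : IsReducedFamilyAt M P x₀)
    [FiniteDimensional ℂ (P x₀).range] :
    ∃ (ι : Type) (_ : Fintype ι) (s : ι → ℂ → ℂ) (p : ι → ℂ → H →L[ℂ] H),
      IsDiagonalizationAt M P x₀ s p := by
  induction hn : Module.finrank ℂ (P x₀).range using Nat.strong_induction_on generalizing M P with
  | _ n ih =>
  subst hn
  by_cases hP0 : P x₀ = 0
  · have hP : ∀ᶠ z in 𝓝 (x₀ : ℂ), ‖P z‖ < 1 :=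
      h.analyticAt_proj.continuousAt.norm.eventually_lt_const (u := 1) (by simp [hP0])
    refine ⟨Empty, inferInstance, isEmptyElim, isEmptyElim, .of_isEmpty ?_⟩
    filter_upwards [h.isIdempotentElem, hP] with z using eq_zero_of_isIdempotentElem_of_norm_lt_one
  have hPi := h.isIdempotentElem.self_of_nhds
  obtain ⟨u, hu⟩ := DFunLike.ne_iff.1 hP0
  obtain ⟨τ, hτ, hscalar | ⟨k, N, hN, hN0, hNP, hvN, hGN⟩⟩ :=
    h.eventually_scalar_or_exists_reduction (DFunLike.congr_fun hPi.eq u) hu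
  · refine ⟨Unit, inferInstance, _, _, .of_unique hτ h.analyticAt_proj hP0 h.isIdempotentElem
      hscalar ?_⟩
    filter_upwards [hscalar, h.commute] with z hz hc
    rw [hc.eq, hz]
  have hvP : P x₀ (P x₀ u) = P x₀ u := DFunLike.congr_fun hPi.eq u
  obtain ⟨P', κ, hκ, hP', hP'P, hPP', hP'0, hNP', hmax⟩ :=
    hN.exists_subprojection hNP hN0 (hN.finite_spectrum hNP)
  have hne : P' x₀ ≠ P x₀ := fun he =>
    inner_apply_ne_zero_of_mul_eq_smul (he ▸ hNP') (Complex.ofReal_ne_zero.2 hκ) hvP hu hvN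
  have hP'i := hP'.isIdempotentElem.self_of_nhds
  have hPP'₀ := hPP'.self_of_nhds
  have hP'P₀ := hP'P.self_of_nhds
  have hPQ₀ : P x₀ * (P x₀ - P' x₀) = P x₀ - P' x₀ := by rw [mul_sub, hPi.eq, hPP'₀]
  have hQP₀ : (P x₀ - P' x₀) * P x₀ = P x₀ - P' x₀ := by rw [sub_mul, hPi.eq, hP'P₀]
  have : FiniteDimensional ℂ (P' x₀).range :=
    Submodule.finiteDimensional_of_le (range_le_range_of_mul_eq hPP'₀)
  have : FiniteDimensional ℂ (P x₀ - P' x₀).range :=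
    Submodule.finiteDimensional_of_le (range_le_range_of_mul_eq hPQ₀)
  obtain ⟨ι, _, s, p, hd⟩ := ih _ (finrank_range_lt_of_ne hP'i hPP'₀ hP'P₀ hne) hP' rfl
  obtain ⟨ι', _, t, q, hd'⟩ := ih _ (finrank_range_lt_of_ne (hP'i.sub hPi hP'P₀ hPP'₀) hPQ₀ hQP₀
    (mt sub_eq_self.1 hP'0)) (hN.sub_proj hP' hP'P hPP') rfl
  exact ⟨ι ⊕ ι', inferInstance, _, _, (hd.sumElim_sub_proj hd' hP'.isIdempotentElem hP'P hPP' hNP'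
    hmax).of_sub_smul_eq_pow_smul hτ h.commute hGN⟩

end IsReducedFamilyAt

end Operators

end Reduction

section Resolvent

namespace UnboundedOp

section LinearPMap

variable {H : Type*} [NormedAddCommGroup H] [InnerProductSpace ℂ H]
  {A : H →ₗ.[ℂ] H} {ζ lam : ℂ} {R R' : H →L[ℂ] H}

theorem shift_eq_shift_sub (f : A.domain) :
    shift A lam f = shift A ζ f - (lam - ζ) • (f : H) := by
  simp only [shift, LinearMap.sub_apply, LinearMap.smul_apply, Submodule.subtype_apply]
  module

theorem mem_eigenspace_iff_exists {x : H} :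
    x ∈ eigenspace A lam ↔ ∃ f : A.domain, shift A lam f = 0 ∧ (f : H) = x := Iff.rfl

/-- `R` is the resolvent `(A - ζ)⁻¹`. -/
structure IsResolvent (A : H →ₗ.[ℂ] H) (ζ : ℂ) (R : H →L[ℂ] H) : Prop where
  exists_shift_eq : ∀ y : H, ∃ f : A.domain, (f : H) = R y ∧ shift A ζ f = y
  apply_shift : ∀ f : A.domain, R (shift A ζ f) = f

theorem isRegularValue_iff_exists_isResolvent :
    IsRegularValue A ζ ↔ ∃ R, IsResolvent A ζ R :=
  exists_congr fun _ => ⟨fun h => ⟨h.1, h.2⟩, fun h => ⟨h.1, h.2⟩⟩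

theorem eigenspace_eq_bot_of_isRegularValue (h : IsRegularValue A lam) : eigenspace A lam = ⊥ := by
  obtain ⟨R, -, hR⟩ := h
  refine (Submodule.eq_bot_iff _).2 ?_
  rintro _ ⟨f, hf, rfl⟩
  have hf0 := hR f
  rw [show shift A lam f = 0 from hf, map_zero] at hf0
  exact hf0.symm

namespace IsResolvent

theorem sub_eq_smul_mul (h : IsResolvent A ζ R) (h' : IsResolvent A lam R') :
    R' - R = (lam - ζ) • (R * R') := by
  ext y
  obtain ⟨f, hf, rfl⟩ := h'.exists_shift_eq y
  have hR := h.apply_shift f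
  rw [shift_eq_shift_sub (ζ := lam), map_sub, map_smul, hf] at hR
  rw [sub_apply, smul_apply, mul_apply_eq_comp, sub_eq_iff_eq_add.1 hR]
  module

theorem isUnit_one_sub_smul (h : IsResolvent A ζ R) (h' : IsResolvent A lam R') :
    IsUnit (1 - (lam - ζ) • R) := by
  have hR := h.sub_eq_smul_mul h'
  have hR' : R' - R = (lam - ζ) • (R' * R) := by
    rw [← neg_sub R R', h'.sub_eq_smul_mul h, ← neg_smul, neg_sub]
  refine ⟨⟨1 - (lam - ζ) • R, 1 + (lam - ζ) • R', ?_, ?_⟩, rfl⟩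
  · rw [sub_mul, one_mul, smul_mul_assoc, mul_add, mul_one, mul_smul_comm, ← hR]
    module
  · rw [add_mul, one_mul, smul_mul_assoc, mul_sub, mul_one, mul_smul_comm, ← hR']
    module

theorem mem_spec_of_mem_spectrum (h : IsResolvent A ζ R) {c σ : ℂ} (hσ0 : σ ≠ 0)
    (hσ : σ ∈ spectrum ℂ (c • R)) : ζ + c / σ ∈ spec A := by
  intro hreg
  obtain ⟨R', hR'⟩ := isRegularValue_iff_exists_isResolvent.1 hreg
  have hu := h.isUnit_one_sub_smul hR'
  rw [add_sub_cancel_left] at hu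
  refine hσ ?_
  have hfactor : algebraMap ℂ (H →L[ℂ] H) σ - c • R =
      algebraMap ℂ (H →L[ℂ] H) σ * (1 - (c / σ) • R) := by
    rw [mul_one_sub, ← Algebra.smul_def, smul_smul, mul_div_cancel₀ _ hσ0]
  rw [spectrum.mem_resolventSet_iff, hfactor]
  exact ((isUnit_iff_ne_zero.2 hσ0).map (algebraMap ℂ (H →L[ℂ] H))).mul hu

theorem mem_eigenspace_iff (h : IsResolvent A ζ R) {c σ : ℂ} (hσ : σ ≠ 0) {x : H} :
    x ∈ eigenspace A (ζ + c / σ) ↔ (c • R) x = σ • x := by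
  have hshift (f : A.domain) : shift A (ζ + c / σ) f = shift A ζ f - (c / σ) • (f : H) := by
    rw [shift_eq_shift_sub (ζ := ζ), add_sub_cancel_left]
  simp only [mem_eigenspace_iff_exists, hshift, sub_eq_zero]
  constructor
  · rintro ⟨f, hf, rfl⟩
    have hR := h.apply_shift f
    rw [hf, map_smul] at hR
    rw [smul_apply, ← inv_smul_eq_iff₀ hσ, smul_smul, inv_mul_eq_div, hR]
  · intro hx
    obtain ⟨f, hfx', hfx⟩ := h.exists_shift_eq x
    have hcx : (c / σ) • (f : H) = x := by
      rw [hfx', ← inv_mul_eq_div, mul_smul, ← smul_apply, hx, inv_smul_smul₀ hσ]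
    refine ⟨(c / σ) • f, ?_, hcx⟩
    rw [map_smul, hfx, Submodule.coe_smul, hcx]

theorem mem_range_shift_iff (h : IsResolvent A ζ R) {c σ : ℂ} (hσ : σ ≠ 0) {x : H} :
    x ∈ (shift A (ζ + c / σ)).range ↔ ∃ u, σ • u - (c • R) u = x := by
  have hshift (f : A.domain) : shift A (ζ + c / σ) f = shift A ζ f - (c / σ) • (f : H) := by
    rw [shift_eq_shift_sub (ζ := ζ), add_sub_cancel_left]
  constructor
  · rintro ⟨f, rfl⟩
    refine ⟨σ⁻¹ • shift A ζ f, ?_⟩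
    rw [hshift, smul_apply, map_smul, h.apply_shift, smul_inv_smul₀ hσ, smul_smul, div_eq_mul_inv]
  · rintro ⟨u, rfl⟩
    obtain ⟨f, hf, hfu⟩ := h.exists_shift_eq (σ • u)
    refine ⟨f, ?_⟩
    rw [hshift, hfu, hf, map_smul, smul_smul, div_mul_cancel₀ _ hσ, smul_apply]

theorem isSelfAdjoint [CompleteSpace H] {ζ : ℝ} (h : IsResolvent A ζ R)
    (hA : ∀ f g : A.domain, inner ℂ (A f) (g : H) = inner ℂ (f : H) (A g)) : IsSelfAdjoint R := by
  rw [ContinuousLinearMap.isSelfAdjoint_iff_isSymmetric]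
  intro x y
  obtain ⟨f, hf, rfl⟩ := h.exists_shift_eq x
  obtain ⟨g, hg, rfl⟩ := h.exists_shift_eq y
  change inner ℂ (R (shift A ζ f)) (A g - (ζ : ℂ) • (g : H)) =
    inner ℂ (A f - (ζ : ℂ) • (f : H)) (R (shift A ζ g))
  rw [← hf, ← hg, inner_sub_left, inner_sub_right, hA, inner_smul_left, inner_smul_right,
    Complex.conj_ofReal]

end IsResolvent

end LinearPMap

section Perturbation

variable {H : Type*} [NormedAddCommGroup H] [InnerProductSpace ℂ H] {D : Submodule ℂ H}

theorem IsResolvent.mul_inverse_one_add {A A' : D →ₗ[ℂ] H} {ζ ζ' : ℂ} {R K : H →L[ℂ] H}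
    (h : IsResolvent ⟨D, A⟩ ζ R)
    (hK : ∀ f : D, shift ⟨D, A'⟩ ζ' f = shift ⟨D, A⟩ ζ f + K f) (hu : IsUnit (1 + K * R)) :
    IsResolvent ⟨D, A'⟩ ζ' (R * Ring.inverse (1 + K * R)) := by
  have hshift (f : D) : shift ⟨D, A'⟩ ζ' f = (1 + K * R) (shift ⟨D, A⟩ ζ f) := by
    rw [hK, add_apply, one_apply_eq_self, mul_apply_eq_comp, h.apply_shift]
  constructor
  · intro y
    obtain ⟨f, hf, hfy⟩ := h.exists_shift_eq (Ring.inverse (1 + K * R) y)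
    refine ⟨f, hf, ?_⟩
    rw [hshift, hfy]
    exact DFunLike.congr_fun (Ring.mul_inverse_cancel _ hu) y
  · intro f
    rw [hshift, mul_apply_eq_comp]
    have hinv := DFunLike.congr_fun (Ring.inverse_mul_cancel _ hu) (shift ⟨D, A⟩ ζ f)
    rw [mul_apply_eq_comp, one_apply_eq_self] at hinv
    rw [hinv, h.apply_shift]

/-- A family `T z = T w + (z - w) B` with bounded `B`, symmetric for real `z`. -/
structure IsSymmetricPencil (T : ℂ → D →ₗ[ℂ] H) (B : H →L[ℂ] H) : Prop where
  apply_eq : ∀ z w f, T z f = T w f + (z - w) • B f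
  symm : ∀ (x : ℝ) (f g : D), inner ℂ (T x f) (g : H) = inner ℂ (f : H) (T x g)

namespace IsSymmetricPencil

variable {T : ℂ → D →ₗ[ℂ] H} {B : H →L[ℂ] H}

theorem shift_eq (hT : IsSymmetricPencil T B) (z z₀ lam lam₀ : ℂ) (f : D) :
    shift ⟨D, T z⟩ lam f =
      shift ⟨D, T z₀⟩ lam₀ f + ((z - z₀) • B - (lam - lam₀) • (1 : H →L[ℂ] H)) f := by
  change T z f - lam • (f : H) = T z₀ f - lam₀ • (f : H) + ((z - z₀) • B f - (lam - lam₀) • (f : H))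
  rw [hT.apply_eq z z₀]
  module

variable [CompleteSpace H]

theorem exists_analyticAt_isResolvent (hT : IsSymmetricPencil T B) {z₀ ζ : ℂ}
    (h : IsRegularValue ⟨D, T z₀⟩ ζ) :
    ∃ R : ℂ → H →L[ℂ] H, AnalyticAt ℂ R z₀ ∧ ∀ᶠ z in 𝓝 z₀, IsResolvent ⟨D, T z⟩ ζ (R z) := by
  obtain ⟨R₀, hR₀⟩ := isRegularValue_iff_exists_isResolvent.1 h
  set K : ℂ → H →L[ℂ] H := fun z => (z - z₀) • B
  have hK : AnalyticAt ℂ (fun z => 1 + K z * R₀) z₀ := by fun_prop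
  have hK₀ : 1 + K z₀ * R₀ = 1 := by simp only [K, sub_self, zero_smul, zero_mul, add_zero]
  have hinv : AnalyticAt ℂ Ring.inverse (1 + K z₀ * R₀) := by
    rw [hK₀]
    exact analyticAt_inverse (1 : (H →L[ℂ] H)ˣ)
  have hunit : ∀ᶠ r in 𝓝 (1 + K z₀ * R₀), IsUnit r := by
    rw [hK₀]
    exact Units.nhds 1
  refine ⟨fun z => R₀ * Ring.inverse (1 + K z * R₀),
    analyticAt_const.mul (AnalyticAt.fun_comp (f := fun z => 1 + K z * R₀) hinv hK), ?_⟩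
  filter_upwards [hK.continuousAt.eventually hunit] with z hz
  refine hR₀.mul_inverse_one_add (fun f => ?_) hz
  rw [hT.shift_eq z z₀ ζ ζ, sub_self, zero_smul, sub_zero]

theorem eventually_eigenspace_eq_bot (hT : IsSymmetricPencil T B) {z₀ lam₀ : ℂ}
    (h : IsRegularValue ⟨D, T z₀⟩ lam₀) :
    ∀ᶠ w in 𝓝 (z₀, lam₀), eigenspace ⟨D, T w.1⟩ w.2 = ⊥ := by
  obtain ⟨R, hR⟩ := isRegularValue_iff_exists_isResolvent.1 h
  set K : ℂ × ℂ → H →L[ℂ] H := fun w => (w.1 - z₀) • B - (w.2 - lam₀) • (1 : H →L[ℂ] H)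
  have hK : ContinuousAt (fun w => 1 + K w * R) (z₀, lam₀) := by fun_prop
  have hunit : ∀ᶠ r in 𝓝 (1 + K (z₀, lam₀) * R), IsUnit r := by
    simp only [K, sub_self, zero_smul, zero_mul, add_zero]
    exact Units.nhds 1
  filter_upwards [hK.eventually hunit] with w hw
  exact eigenspace_eq_bot_of_isRegularValue (isRegularValue_iff_exists_isResolvent.2
    ⟨_, hR.mul_inverse_one_add (hT.shift_eq w.1 z₀ w.2 lam₀) hw⟩)

end IsSymmetricPencil

end Perturbation

end UnboundedOp

end Resolvent

section Cluster

theorem exists_isStarProjection_norm_sub_le {A : Type*} [CStarAlgebra A] {a : A}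
    (ha : IsSelfAdjoint a) {ε : ℝ} (hε₀ : 0 ≤ ε) (hε₁ : ε < 1)
    (hs : ∀ σ ∈ spectrum ℂ a, σ = 1 ∨ ‖σ‖ ≤ ε) :
    ∃ p : A, IsStarProjection p ∧ a * p = p ∧ ‖a - p‖ ≤ ε := by
  set f : ℝ → ℝ := fun t => max 0 (min 1 ((t - ε) / (1 - ε)))
  have hf : Continuous f := by fun_prop
  have hf₁ : f 1 = 1 := by
    simp only [f, div_self (sub_pos.2 hε₁).ne', min_self, zero_le_one, sup_of_le_right]
  have hf₀ (t : ℝ) (ht : |t| ≤ ε) : f t = 0 :=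
    max_eq_left ((min_le_right _ _).trans (div_nonpos_of_nonpos_of_nonneg
      (sub_nonpos.2 (abs_le.1 ht).2) (sub_pos.2 hε₁).le))
  have hsℝ (t : ℝ) (ht : t ∈ spectrum ℝ a) : t = 1 ∨ |t| ≤ ε := by
    simpa using hs t ((spectrum.algebraMap_mem_iff ℂ).2 ht)
  refine ⟨cfc f a, ⟨?_, .cfc⟩, ?_, ?_⟩
  · rw [IsIdempotentElem, ← cfc_mul f f a hf.continuousOn hf.continuousOn]
    refine cfc_congr fun t ht => ?_
    rcases hsℝ t ht with rfl | h
    · simp only [hf₁, mul_one]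
    · simp only [hf₀ t h, mul_zero]
  · nth_rewrite 1 [← cfc_id' ℝ a ha]
    rw [← cfc_mul (fun t => t) f a continuousOn_id hf.continuousOn]
    refine cfc_congr fun t ht => ?_
    rcases hsℝ t ht with rfl | h
    · simp only [hf₁, mul_one]
    · simp only [hf₀ t h, mul_zero]
  · nth_rewrite 1 [← cfc_id' ℝ a ha]
    rw [← cfc_sub (fun t => t) f a continuousOn_id hf.continuousOn]
    refine norm_cfc_le hε₀ fun t ht => ?_
    rcases hsℝ t ht with rfl | h
    · simpa only [hf₁, sub_self, norm_zero] using hε₀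
    · simpa only [hf₀ t h, sub_zero, Real.norm_eq_abs] using h

/-- The projections `p` reduce `S`, with `S = s j` on the range of `p j`, and `S` has norm less
than `r` on the complement: so `p` captures all of the spectrum of `S` outside the `r`-ball. -/
structure IsSpectralCluster {𝕜 E ι : Type*} [NontriviallyNormedField 𝕜] [NormedAddCommGroup E]
    [NormedSpace 𝕜 E] [Fintype ι] (S : E →L[𝕜] E) (r : ℝ) (s : ι → 𝕜) (p : ι → E →L[𝕜] E) :
    Prop where
  orthogonal : OrthogonalIdempotents p
  mul_proj : ∀ j, S * p j = s j • p j
  proj_mul : ∀ j, p j * S = s j • p j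
  norm_lt : ‖S * (1 - ∑ j, p j)‖ < r

namespace IsSpectralCluster

variable {𝕜 E ι : Type*} [NontriviallyNormedField 𝕜] [NormedAddCommGroup E] [NormedSpace 𝕜 E]
  [Fintype ι] {S : E →L[𝕜] E} {r : ℝ} {s : ι → 𝕜} {p : ι → E →L[𝕜] E} {σ : 𝕜} {x : E}

theorem commute_sum (h : IsSpectralCluster S r s p) : Commute S (∑ j, p j) := by
  rw [commute_iff_eq, Finset.mul_sum, Finset.sum_mul]
  exact Finset.sum_congr rfl fun j _ => (h.mul_proj j).trans (h.proj_mul j).symm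

theorem sum_apply_eq_self (h : IsSpectralCluster S r s p) (hσ : r ≤ ‖σ‖) (hx : S x = σ • x) :
    (∑ j, p j) x = x := by
  set P := ∑ j, p j
  have hQ : (S * (1 - P)) (x - P x) = σ • (x - P x) := by
    have hcomm : S * (1 - P) * (1 - P) = (1 - P) * S := by
      rw [mul_assoc, h.orthogonal.isIdempotentElem_sum.one_sub.eq, mul_sub, sub_mul, h.commute_sum,
        mul_one, one_mul]
    calc (S * (1 - P)) (x - P x) = (S * (1 - P) * (1 - P)) x := rfl
      _ = σ • (x - P x) := by
        rw [hcomm, mul_apply_eq_comp, hx, map_smul, sub_apply, one_apply_eq_self]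
  have hle := (S * (1 - P)).le_opNorm (x - P x)
  rw [hQ, norm_smul] at hle
  have hzero : ‖x - P x‖ = 0 := by
    by_contra hne
    have hpos : 0 < ‖x - P x‖ := (norm_nonneg _).lt_of_ne' hne
    exact absurd (le_of_mul_le_mul_right hle hpos) (h.norm_lt.trans_le hσ).not_ge
  exact (sub_eq_zero.1 (norm_eq_zero.1 hzero)).symm

theorem apply_eq_zero (h : IsSpectralCluster S r s p) {i : ι} (hσ : s i ≠ σ) (hx : S x = σ • x) :
    p i x = 0 := by
  have hi : p i (S x) = s i • p i x := DFunLike.congr_fun (h.proj_mul i) x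
  rw [hx, map_smul, ← sub_eq_zero, ← sub_smul] at hi
  exact (smul_eq_zero.1 hi).resolve_left (sub_ne_zero.2 hσ.symm)

theorem exists_eigenvalue_eq (h : IsSpectralCluster S r s p) (hσ : r ≤ ‖σ‖) (hx : S x = σ • x)
    (hx₀ : x ≠ 0) : ∃ j, s j = σ := by
  by_contra! hne
  refine hx₀ ?_
  rw [← h.sum_apply_eq_self hσ hx, sum_apply]
  exact Finset.sum_eq_zero fun j _ => h.apply_eq_zero (hne j) hx

theorem mem_range_iff (h : IsSpectralCluster S r s p) {j : ι} (hr : r ≤ ‖s j‖)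
    (hne : ∀ i, i ≠ j → s i ≠ s j) : x ∈ (p j).range ↔ S x = s j • x := by
  rw [mem_range_iff_apply_eq_self (h.orthogonal.idem j)]
  refine ⟨fun hx => ?_, fun hx => ?_⟩
  · have hS := DFunLike.congr_fun (h.mul_proj j) x
    rwa [mul_apply_eq_comp, smul_apply, hx] at hS
  · have hsum := h.sum_apply_eq_self hr hx
    rwa [sum_apply, Finset.sum_eq_single_of_mem j (Finset.mem_univ j) fun i _ hi =>
      h.apply_eq_zero (hne i hi) hx] at hsum

variable [CompleteSpace E]

theorem exists_smul_sub_apply_eq (h : IsSpectralCluster S r s p) (hσ : r ≤ ‖σ‖) {y : E}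
    (hy : (∑ j, p j) y = 0) : ∃ u, σ • u - S u = y := by
  set P := ∑ j, p j
  have hlt : ‖S * (1 - P)‖ < ‖σ‖ := h.norm_lt.trans_le hσ
  have hσ₀ : σ ≠ 0 := norm_pos_iff.1 ((norm_nonneg _).trans_lt hlt)
  have hlt₁ : ‖σ⁻¹ • (S * (1 - P))‖ < 1 := by
    rwa [norm_smul, norm_inv, inv_mul_lt_one₀ (norm_pos_iff.2 hσ₀)]
  obtain ⟨v, hv⟩ : ∃ v, (1 - σ⁻¹ • (S * (1 - P)) : E →L[𝕜] E) v = y :=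
    ⟨_, DFunLike.congr_fun (Units.oneSub _ hlt₁).mul_inv y⟩
  have hcomm : (1 - P) * (1 - σ⁻¹ • (S * (1 - P))) = (1 - σ⁻¹ • S) * (1 - P) := by
    have hidem : (1 - P) * (1 - P) = 1 - P := h.orthogonal.isIdempotentElem_sum.one_sub.eq
    have hS : (1 - P) * S = S * (1 - P) := by rw [mul_sub, sub_mul, h.commute_sum, mul_one, one_mul]
    rw [mul_sub, mul_smul_comm, ← mul_assoc, hS, mul_assoc, hidem, mul_one, sub_mul, one_mul,
      smul_mul_assoc]
  have hPy : (1 - P) y = y := by rw [sub_apply, one_apply_eq_self, hy, sub_zero]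
  rw [← hv, ← mul_apply_eq_comp, hcomm, hv] at hPy
  refine ⟨σ⁻¹ • (1 - P) v, ?_⟩
  rw [smul_inv_smul₀ hσ₀, map_smul]
  exact hPy

theorem apply_eq_zero_iff (h : IsSpectralCluster S r s p) {j : ι} (hr : r ≤ ‖s j‖)
    (hne : ∀ i, i ≠ j → s i ≠ s j) : p j x = 0 ↔ ∃ u, s j • u - S u = x := by
  classical
  constructor
  · intro hx
    obtain ⟨u, hu⟩ := h.exists_smul_sub_apply_eq hr (y := x - (∑ i, p i) x) (by
      rw [map_sub, ← mul_apply_eq_comp, h.orthogonal.isIdempotentElem_sum.eq, sub_self])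
    refine ⟨u + ∑ i ∈ Finset.univ.erase j, (s j - s i)⁻¹ • p i x, ?_⟩
    have hterm : ∀ i ∈ Finset.univ.erase j,
        s j • ((s j - s i)⁻¹ • p i x) - S ((s j - s i)⁻¹ • p i x) = p i x := by
      intro i hi
      have hS : S (p i x) = s i • p i x := DFunLike.congr_fun (h.mul_proj i) x
      rw [map_smul, hS, smul_comm (s j), ← smul_sub, ← sub_smul, inv_smul_smul₀]
      exact sub_ne_zero.2 (hne i (Finset.ne_of_mem_erase hi)).symm
    have hsum : (∑ i, p i) x = ∑ i ∈ Finset.univ.erase j, p i x := by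
      rw [sum_apply, ← Finset.add_sum_erase _ _ (Finset.mem_univ j), hx, zero_add]
    rw [smul_add, map_add, add_sub_add_comm, hu, Finset.smul_sum, map_sum,
      ← Finset.sum_sub_distrib, Finset.sum_congr rfl hterm, hsum, sub_add_cancel]
  · rintro ⟨u, rfl⟩
    have hS : p j (S u) = s j • p j u := DFunLike.congr_fun (h.proj_mul j) u
    rw [map_sub, map_smul, hS, sub_self]

end IsSpectralCluster

namespace UnboundedOp

theorem IsResolvent.isEigenprojector {H ι : Type*} [NormedAddCommGroup H] [InnerProductSpace ℂ H]
    [CompleteSpace H] [Fintype ι] {A : H →ₗ.[ℂ] H} {ζ c : ℂ} {R : H →L[ℂ] H} {r : ℝ} {s : ι → ℂ}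
    {p : ι → H →L[ℂ] H} (h : IsResolvent A ζ R) (hp : IsSpectralCluster (c • R) r s p) {j : ι}
    (hr : r ≤ ‖s j‖) (hne : ∀ i, i ≠ j → s i ≠ s j) : IsEigenprojector A (ζ + c / s j) (p j) := by
  have hs₀ : s j ≠ 0 := norm_pos_iff.1 ((norm_nonneg _).trans_lt (hp.norm_lt.trans_le hr))
  refine ⟨hp.orthogonal.idem j, ?_, ?_⟩
  · ext x
    exact (hp.mem_range_iff hr hne).trans (h.mem_eigenspace_iff hs₀).symm
  · ext x
    exact (hp.apply_eq_zero_iff hr hne).trans (h.mem_range_shift_iff hs₀).symm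

theorem IsResolvent.eq_one_or_norm_le_of_mem_spectrum {H : Type*} [NormedAddCommGroup H]
    [InnerProductSpace ℂ H] {A : H →ₗ.[ℂ] H} {ζ c σ : ℂ} {R : H →L[ℂ] H} {ε δ : ℝ}
    (h : IsResolvent A ζ R) (hiso : ∀ w, dist w (ζ + c) < δ → w ≠ ζ + c → w ∉ spec A)
    (hc : c ≠ 0) (hε : 0 < ε) (hδ : ‖c‖ * (ε⁻¹ + 1) ≤ δ) (hσ : σ ∈ spectrum ℂ (c • R)) :
    σ = 1 ∨ ‖σ‖ ≤ ε := by
  by_contra! hcon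
  obtain ⟨hσ₁, hσε⟩ := hcon
  have hσ₀ : σ ≠ 0 := norm_pos_iff.1 (hε.trans hσε)
  refine hiso (ζ + c / σ) ?_ (fun he => hσ₁ ?_) (h.mem_spec_of_mem_spectrum hσ₀ hσ)
  · calc dist (ζ + c / σ) (ζ + c) = ‖c‖ * ‖σ⁻¹ - 1‖ := by
          rw [dist_eq_norm, add_sub_add_left_eq_sub, div_eq_mul_inv, ← norm_mul, mul_sub_one]
      _ ≤ ‖c‖ * (‖σ‖⁻¹ + 1) := by
          gcongr
          simpa only [norm_inv, norm_one] using norm_sub_le σ⁻¹ 1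
      _ < ‖c‖ * (ε⁻¹ + 1) := by
          have := norm_pos_iff.2 hc
          gcongr
      _ ≤ δ := hδ
  · rwa [add_right_inj, div_eq_iff hσ₀, left_eq_mul₀ hc] at he

end UnboundedOp

end Cluster

section Splitting

open Module

theorem eventually_finrank_range_eq {X 𝕜 E : Type*} [NontriviallyNormedField 𝕜]
    [NormedAddCommGroup E] [NormedSpace 𝕜 E] {l : Filter X} {p : E →L[𝕜] E} {q : X → E →L[𝕜] E}
    (hq : Tendsto q l (𝓝 p)) (hp : IsIdempotentElem p) (hqi : ∀ᶠ x in l, IsIdempotentElem (q x))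
    [FiniteDimensional 𝕜 p.range] : ∀ᶠ x in l, finrank 𝕜 (q x).range = finrank 𝕜 p.range := by
  have hnorm : ∀ᶠ x in l, ‖p - q x‖ < 1 := by
    refine (hq.const_sub p).norm.eventually_lt_const ?_
    rw [sub_self, norm_zero]
    exact zero_lt_one
  filter_upwards [hqi, hnorm] with x hx hlt
  exact (finrank_range_eq_of_norm_sub_lt_one hp hx hlt).2

namespace UnboundedOp

/-- `P` is a nonzero projection onto a subspace of the eigenspace of `A` at `lam`. -/
structure IsEigenSubprojector {H : Type*} [NormedAddCommGroup H] [InnerProductSpace ℂ H]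
    (A : H →ₗ.[ℂ] H) (lam : ℂ) (P : H →L[ℂ] H) : Prop where
  ne_zero : P ≠ 0
  isIdempotentElem : IsIdempotentElem P
  range_le : P.range ≤ eigenspace A lam

variable {H : Type*} [NormedAddCommGroup H] [InnerProductSpace ℂ H] {D : Submodule ℂ H}

/-- Analytic families of eigenvalues `l j z` and projections `p j z` that describe the spectrum of
`T z` near `lam₀` for `z` near `z₀`, and that are pairwise distinct except possibly at `z₀`. -/
structure IsEigenSplittingAt {ι : Type*} (T : ℂ → D →ₗ[ℂ] H) (z₀ lam₀ : ℂ) (l : ι → ℂ → ℂ)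
    (p : ι → ℂ → H →L[ℂ] H) : Prop where
  analyticAt_eigenvalue : ∀ j, AnalyticAt ℂ (l j) z₀
  analyticAt_proj : ∀ j, AnalyticAt ℂ (p j) z₀
  isEigenSubprojector : ∀ᶠ z in 𝓝 z₀, ∀ j, IsEigenSubprojector ⟨D, T z⟩ (l j z) (p j z)
  isEigenprojector : ∀ᶠ z in 𝓝 z₀, ∀ j, (∀ i, i ≠ j → l i z ≠ l j z) →
    IsEigenprojector ⟨D, T z⟩ (l j z) (p j z)
  injective : ∀ᶠ z in 𝓝[≠] z₀, Function.Injective (l · z)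
  finrank_eq : ∀ᶠ z in 𝓝 z₀, ∀ j, finrank ℂ (p j z).range = finrank ℂ (p j z₀).range
  exhausts : ∀ᶠ w in 𝓝 (z₀, lam₀), eigenspace ⟨D, T w.1⟩ w.2 ≠ ⊥ → ∃ j, l j w.1 = w.2
  unique : ∀ j, finrank ℂ (p j z₀).range = finrank ℂ (eigenspace ⟨D, T z₀⟩ lam₀) → ∀ i, i = j

theorem IsEigenSplittingAt.of_isEmpty {ι : Type*} [IsEmpty ι] {T : ℂ → D →ₗ[ℂ] H} {z₀ lam₀ : ℂ}
    {l : ι → ℂ → ℂ} {p : ι → ℂ → H →L[ℂ] H}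
    (h : ∀ᶠ w in 𝓝 (z₀, lam₀), eigenspace ⟨D, T w.1⟩ w.2 = ⊥) :
    IsEigenSplittingAt T z₀ lam₀ l p where
  analyticAt_eigenvalue := isEmptyElim
  analyticAt_proj := isEmptyElim
  isEigenSubprojector := .of_forall fun _ => isEmptyElim
  isEigenprojector := .of_forall fun _ => isEmptyElim
  injective := .of_forall fun _ i => isEmptyElim i
  finrank_eq := .of_forall fun _ => isEmptyElim
  exhausts := h.mono fun _ hbot hne => absurd hbot hne
  unique := isEmptyElim

variable [CompleteSpace H]

/-- The part of `T z` with spectrum near `ζ + c`, for `z` near `x₀`, in terms of the scaled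
resolvent `S z = c (T z - ζ)⁻¹`: at `x₀` the projection `P x₀` is onto the eigenspace of `S x₀` at
`1`, and the rest of `S x₀` is small. -/
structure IsResolventClusterAt (T : ℂ → D →ₗ[ℂ] H) (x₀ ζ c : ℝ) (S P : ℂ → H →L[ℂ] H) :
    Prop where
  ne_zero : c ≠ 0
  exists_isResolvent : ∀ᶠ z in 𝓝 (x₀ : ℂ), ∃ R, IsResolvent ⟨D, T z⟩ ζ R ∧ S z = (c : ℂ) • R
  isReducedFamilyAt : IsReducedFamilyAt S P x₀
  mul_proj : S x₀ * P x₀ = P x₀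
  norm_lt : ‖S x₀ * (1 - P x₀)‖ < 1 / 2

theorem IsSymmetricPencil.exists_isResolventClusterAt {T : ℂ → D →ₗ[ℂ] H} {B : H →L[ℂ] H}
    (hT : IsSymmetricPencil T B) {x₀ lam₀ : ℝ}
    (hiso : ∀ᶠ w in 𝓝[≠] (lam₀ : ℂ), w ∉ spec ⟨D, T x₀⟩) :
    ∃ (ζ c : ℝ) (S P : ℂ → H →L[ℂ] H), ζ + c = lam₀ ∧ IsResolventClusterAt T x₀ ζ c S P := by
  obtain ⟨δ, hδ, hball⟩ := Metric.eventually_nhds_iff.1 (eventually_nhdsWithin_iff.1 hiso)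
  set c := δ / 101 with hc
  have hc₀ : 0 < c := by positivity
  have hcn : ‖(c : ℂ)‖ = c := Complex.norm_of_nonneg hc₀.le
  set ζ := lam₀ - c with hζ
  have hζc : (ζ : ℂ) + c = lam₀ := by rw [hζ, Complex.ofReal_sub, sub_add_cancel]
  have hζreg : IsRegularValue ⟨D, T x₀⟩ ζ := by
    have hsub : (ζ : ℂ) - lam₀ = -c := by rw [← hζc, sub_add_cancel_left]
    refine not_not.1 (hball ?_ (sub_ne_zero.1 ?_))
    · rw [dist_eq_norm, hsub, norm_neg, hcn]
      linarith
    · exact hsub ▸ neg_ne_zero.2 (Complex.ofReal_ne_zero.2 hc₀.ne')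
  obtain ⟨R, hR, hres⟩ := hT.exists_analyticAt_isResolvent hζreg
  set S : ℂ → H →L[ℂ] H := fun z => (c : ℂ) • R z
  have hS : AnalyticAt ℂ S x₀ := hR.fun_const_smul
  have hSs : ∀ᶠ x : ℝ in 𝓝 x₀, IsSelfAdjoint (S x) := by
    filter_upwards [eventually_ofReal hres] with x hx
    exact IsSelfAdjoint.smul (Complex.conj_ofReal c) (hx.isSelfAdjoint (hT.symm x))
  obtain ⟨p, hp, hSp, hnear⟩ := exists_isStarProjection_norm_sub_le hSs.self_of_nhds
    (ε := 1 / 100) (by norm_num) (by norm_num) fun σ =>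
      hres.self_of_nhds.eq_one_or_norm_le_of_mem_spectrum (hζc ▸ hball)
        (Complex.ofReal_ne_zero.2 hc₀.ne') (by norm_num) (by rw [hcn]; linarith)
  have hcomm : Commute (S x₀) p :=
    (hSs.self_of_nhds.commute_iff hp.isSelfAdjoint).2 (hSp.symm ▸ hp.isSelfAdjoint)
  have hP₀ : idempotentNear ℂ (S x₀) = p :=
    idempotentNear_eq_of_norm_sub_le hp.isIdempotentElem hp.norm_le hcomm hnear
  have hdef : ‖S x₀ - S x₀ ^ 2‖ < 1 / 4 := by
    have := norm_sub_sq_le_of_isIdempotentElem (q := S x₀) hp.isIdempotentElem hp.norm_le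
    nlinarith [norm_nonneg (S x₀ - p)]
  refine ⟨ζ, c, S, fun z => idempotentNear ℂ (S z), sub_add_cancel _ _, hc₀.ne',
    hres.mono fun z hz => ⟨R z, hz, rfl⟩, ⟨hS, ?_, ?_, ?_, hSs, ?_⟩, ?_, ?_⟩
  · exact (analyticAt_idempotentNear hdef).fun_comp hS
  · exact eventually_isIdempotentElem_idempotentNear hS.continuousAt hdef
  · exact .of_forall fun z => commute_idempotentNear (.refl _)
  · exact hSs.mono fun x hx => isSelfAdjoint_idempotentNear hx
  · rw [hP₀, hSp]
  · rw [hP₀, mul_sub, mul_one, hSp]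
    linarith

namespace IsResolventClusterAt

variable {T : ℂ → D →ₗ[ℂ] H} {x₀ ζ c : ℝ} {S P : ℂ → H →L[ℂ] H}

theorem range_proj_eq (h : IsResolventClusterAt T x₀ ζ c S P) :
    (P x₀).range = eigenspace ⟨D, T x₀⟩ (ζ + c) := by
  obtain ⟨R, hR, hS⟩ := h.exists_isResolvent.self_of_nhds
  have hidem := h.isReducedFamilyAt.isIdempotentElem.self_of_nhds
  have hcl : IsSpectralCluster (S x₀) (1 / 2) (fun _ : Unit => (1 : ℂ)) fun _ => P x₀ := by
    refine ⟨⟨fun _ => hidem, Subsingleton.pairwise⟩, fun _ => ?_, fun _ => ?_, ?_⟩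
    · rw [h.mul_proj, one_smul]
    · rw [h.isReducedFamilyAt.commute.self_of_nhds, h.mul_proj, one_smul]
    · simpa only [Fintype.sum_unique] using h.norm_lt
  ext x
  rw [hcl.mem_range_iff (j := ()) (by norm_num) fun i hi => absurd rfl hi, hS,
    ← hR.mem_eigenspace_iff one_ne_zero, div_one]

variable {ι : Type*} [Fintype ι] {s : ι → ℂ → ℂ} {p : ι → ℂ → H →L[ℂ] H}

theorem eigenvalue_eq_one (h : IsResolventClusterAt T x₀ ζ c S P)
    (hd : IsDiagonalizationAt S P (x₀ : ℂ) s p) (j : ι) : s j x₀ = 1 :=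
  hd.eigenvalue_eq_of_mul_eq_smul (by rw [h.mul_proj, one_smul]) j

theorem eventually_half_le_norm (h : IsResolventClusterAt T x₀ ζ c S P)
    (hd : IsDiagonalizationAt S P (x₀ : ℂ) s p) :
    ∀ᶠ z in 𝓝 (x₀ : ℂ), ∀ j, 1 / 2 ≤ ‖s j z‖ := by
  refine eventually_all.2 fun j => ?_
  have hhalf : 1 / 2 < ‖s j x₀‖ := by
    rw [h.eigenvalue_eq_one hd, norm_one]
    norm_num
  exact ((hd.analyticAt_eigenvalue j).continuousAt.norm.eventually_const_lt hhalf).mono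
    fun z hz => hz.le

theorem eventually_isSpectralCluster (h : IsResolventClusterAt T x₀ ζ c S P)
    (hd : IsDiagonalizationAt S P (x₀ : ℂ) s p) :
    ∀ᶠ z in 𝓝 (x₀ : ℂ), IsSpectralCluster (S z) (1 / 2) (s · z) (p · z) := by
  have hnorm : ∀ᶠ z in 𝓝 (x₀ : ℂ), ‖S z * (1 - P z)‖ < 1 / 2 :=
    (h.isReducedFamilyAt.analyticAt.continuousAt.mul
      (h.isReducedFamilyAt.analyticAt_proj.continuousAt.const_sub 1)).norm.eventually_lt_const
      h.norm_lt
  filter_upwards [hd.orthogonal, hd.mul_proj, hd.proj_mul, hd.sum_eq, hnorm]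
    with z ho hl hr hsum hn
  exact ⟨ho, hl, hr, hsum ▸ hn⟩

theorem eventually_isEigenprojector (h : IsResolventClusterAt T x₀ ζ c S P)
    (hd : IsDiagonalizationAt S P (x₀ : ℂ) s p) :
    ∀ᶠ z in 𝓝 (x₀ : ℂ), ∀ j, (∀ i, i ≠ j → s i z ≠ s j z) →
      IsEigenprojector ⟨D, T z⟩ (ζ + c / s j z) (p j z) := by
  filter_upwards [h.exists_isResolvent, h.eventually_isSpectralCluster hd,
    h.eventually_half_le_norm hd] with z ⟨R, hR, hS⟩ hcl hhalf j hj
  rw [hS] at hcl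
  exact hR.isEigenprojector hcl (hhalf j) hj

theorem eventually_isEigenSubprojector (h : IsResolventClusterAt T x₀ ζ c S P)
    (hd : IsDiagonalizationAt S P (x₀ : ℂ) s p) :
    ∀ᶠ z in 𝓝 (x₀ : ℂ), ∀ j, IsEigenSubprojector ⟨D, T z⟩ (ζ + c / s j z) (p j z) := by
  have hne : ∀ᶠ z in 𝓝 (x₀ : ℂ), ∀ j, s j z ≠ 0 ∧ p j z ≠ 0 :=
    eventually_all.2 fun j => ((hd.analyticAt_eigenvalue j).continuousAt.eventually_ne
      (h.eigenvalue_eq_one hd j ▸ one_ne_zero)).and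
      ((hd.analyticAt_proj j).continuousAt.eventually_ne (hd.ne_zero j))
  filter_upwards [hne, hd.orthogonal, hd.mul_proj, h.exists_isResolvent]
    with z hz ho hl ⟨R, hR, hS⟩ j
  refine ⟨(hz j).2, ho.idem j, ?_⟩
  rintro _ ⟨x, rfl⟩
  rw [hR.mem_eigenspace_iff (hz j).1, ← hS]
  exact DFunLike.congr_fun (hl j) x

theorem eventually_exists_eigenvalue_eq (h : IsResolventClusterAt T x₀ ζ c S P)
    (hd : IsDiagonalizationAt S P (x₀ : ℂ) s p) :
    ∀ᶠ w in 𝓝 ((x₀ : ℂ), (ζ + c : ℂ)), eigenspace ⟨D, T w.1⟩ w.2 ≠ ⊥ →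
      ∃ j, ζ + c / s j w.1 = w.2 := by
  have hc₀ : (c : ℂ) ≠ 0 := Complex.ofReal_ne_zero.2 h.ne_zero
  set σ : ℂ × ℂ → ℂ := fun w => c / (w.2 - ζ)
  have hσ₀ : 1 / 2 < ‖σ (x₀, ζ + c)‖ := by
    simp only [σ, add_sub_cancel_left, div_self hc₀, norm_one]
    norm_num
  have hσ : ContinuousAt σ (x₀, ζ + c) := by
    refine continuousAt_const.div (by fun_prop) ?_
    rwa [add_sub_cancel_left]
  have hhalf : ∀ᶠ w in 𝓝 ((x₀ : ℂ), (ζ + c : ℂ)), 1 / 2 < ‖σ w‖ :=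
    hσ.norm.eventually_const_lt hσ₀
  have hfst : ContinuousAt Prod.fst ((x₀ : ℂ), (ζ + c : ℂ)) := continuousAt_fst
  filter_upwards [hhalf, hfst.eventually h.exists_isResolvent,
    hfst.eventually (h.eventually_isSpectralCluster hd)] with w hw ⟨R, hR, hS⟩ hcl hbot
  have hσw : σ w ≠ 0 := norm_pos_iff.1 (one_half_pos.trans hw)
  have hw₂ : ζ + c / σ w = w.2 := by rw [div_div_cancel₀ hc₀, add_sub_cancel]
  obtain ⟨x, hx, hx₀⟩ := Submodule.exists_mem_ne_zero_of_ne_bot hbot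
  rw [← hw₂, hR.mem_eigenspace_iff hσw, ← hS] at hx
  obtain ⟨j, hj⟩ := hcl.exists_eigenvalue_eq hw.le hx hx₀
  exact ⟨j, by rw [hj, hw₂]⟩

theorem eq_of_finrank_range_eq (h : IsResolventClusterAt T x₀ ζ c S P)
    (hd : IsDiagonalizationAt S P (x₀ : ℂ) s p) [FiniteDimensional ℂ (P x₀).range] {j : ι}
    (hj : finrank ℂ (p j x₀).range = finrank ℂ (eigenspace ⟨D, T x₀⟩ (ζ + c))) (i : ι) :
    i = j := by
  have hmul := hd.mul_proj_eq.self_of_nhds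
  have ho := hd.orthogonal.self_of_nhds
  have hrange : (p j x₀).range = (P x₀).range :=
    Submodule.eq_of_le_of_finrank_eq (range_le_range_of_mul_eq (hmul j))
      (by rw [hj, h.range_proj_eq])
  by_contra hij
  refine hd.ne_zero i (ContinuousLinearMap.ext fun x => ?_)
  have hx : p i x₀ x ∈ (p j x₀).range :=
    hrange ▸ range_le_range_of_mul_eq (hmul i) (LinearMap.mem_range_self _ x)
  rw [← (mem_range_iff_apply_eq_self (ho.idem j)).1 hx]
  exact DFunLike.congr_fun (ho.ortho (Ne.symm hij)) x

theorem isEigenSplittingAt (h : IsResolventClusterAt T x₀ ζ c S P)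
    (hd : IsDiagonalizationAt S P (x₀ : ℂ) s p) [FiniteDimensional ℂ (P x₀).range] :
    IsEigenSplittingAt T x₀ (ζ + c) (fun j z => ζ + c / s j z) p := by
  have hinj {σ τ : ℂ} : (ζ : ℂ) + c / σ = ζ + c / τ ↔ σ = τ := by
    rw [add_right_inj, div_eq_mul_inv, div_eq_mul_inv,
      mul_right_inj' (Complex.ofReal_ne_zero.2 h.ne_zero), inv_inj]
  have hfin (j : ι) : FiniteDimensional ℂ (p j x₀).range :=
    Submodule.finiteDimensional_of_le (range_le_range_of_mul_eq (hd.mul_proj_eq.self_of_nhds j))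
  refine ⟨fun j => ?_, hd.analyticAt_proj, h.eventually_isEigenSubprojector hd, ?_, ?_,
    eventually_all.2 fun j => ?_, h.eventually_exists_eigenvalue_eq hd,
    fun j => h.eq_of_finrank_range_eq hd⟩
  · exact analyticAt_const.add (analyticAt_const.div (hd.analyticAt_eigenvalue j)
      (h.eigenvalue_eq_one hd j ▸ one_ne_zero))
  · simpa only [ne_eq, hinj] using h.eventually_isEigenprojector hd
  · exact hd.injective.mono fun z hz i j hij => hz (hinj.1 hij)
  · exact eventually_finrank_range_eq (hd.analyticAt_proj j).continuousAt
      (hd.orthogonal.self_of_nhds.idem j) (hd.orthogonal.mono fun z hz => hz.idem j)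

end IsResolventClusterAt

theorem IsSymmetricPencil.exists_isEigenSplittingAt {T : ℂ → D →ₗ[ℂ] H} {B : H →L[ℂ] H}
    (hT : IsSymmetricPencil T B) {x₀ : ℝ} (hdisc : HasDiscreteSpectrum ⟨D, T x₀⟩) (lam₀ : ℝ) :
    ∃ (ι : Type) (_ : Finite ι) (l : ι → ℂ → ℂ) (p : ι → ℂ → H →L[ℂ] H),
      IsEigenSplittingAt T x₀ lam₀ l p := by
  by_cases hreg : IsRegularValue ⟨D, T x₀⟩ (lam₀ : ℂ)
  · exact ⟨Empty, inferInstance, fun j => j.elim, fun j => j.elim,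
      .of_isEmpty (hT.eventually_eigenspace_eq_bot hreg)⟩
  obtain ⟨hiso, m, hm₀, hm⟩ := hdisc _ hreg
  obtain ⟨ζ, c, S, P, rfl, h⟩ := hT.exists_isResolventClusterAt hiso
  rw [Complex.ofReal_add, ← h.range_proj_eq] at hm
  have : FiniteDimensional ℂ (P x₀).range :=
    FiniteDimensional.of_finrank_pos (hm ▸ Nat.pos_of_ne_zero hm₀)
  obtain ⟨ι, _, s, p, hd⟩ := h.isReducedFamilyAt.exists_isDiagonalizationAt
  refine ⟨ι, inferInstance, fun j z => ζ + c / s j z, p, ?_⟩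
  rw [Complex.ofReal_add]
  exact h.isEigenSplittingAt hd

end UnboundedOp

end Splitting

section Branches

open Module

theorem analyticAt_comp_ofReal {E : Type*} [NormedAddCommGroup E] [NormedSpace ℂ E] {G : ℂ → E}
    {x : ℝ} (h : AnalyticAt ℂ G x) : AnalyticAt ℝ (fun y : ℝ => G y) x :=
  h.restrictScalars.comp (Complex.ofRealCLM.analyticAt x)

theorem eventually_nhds_eventually_nhdsNE {X : Type*} [TopologicalSpace X] [T1Space X] {a : X}
    {p : X → Prop} (h : ∀ᶠ x in 𝓝[≠] a, p x) : ∀ᶠ y in 𝓝 a, ∀ᶠ x in 𝓝[≠] y, p x := by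
  have hne := eventually_nhdsWithin_iff.1 (eventually_nhdsNE_eventually_nhds_iff.2 h)
  filter_upwards [hne] with y hy
  rcases eq_or_ne y a with rfl | hya
  · exact h
  · exact (hy hya).filter_mono nhdsWithin_le_nhds

namespace UnboundedOp

variable {H : Type*} [NormedAddCommGroup H] [InnerProductSpace ℂ H] {D : Submodule ℂ H}

theorem IsEigenprojector.eq {A : H →ₗ.[ℂ] H} {lam : ℂ} {P Q : H →L[ℂ] H}
    (hP : IsEigenprojector A lam P) (hQ : IsEigenprojector A lam Q) : P = Q := by
  have hPQ (x : H) : P (Q x) = Q x := by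
    refine (mem_range_iff_apply_eq_self hP.1).1 ?_
    change Q x ∈ LinearMap.range (P : H →ₗ[ℂ] H)
    rw [hP.2.1, ← hQ.2.1]
    exact ⟨x, rfl⟩
  have hker (x : H) : P (x - Q x) = 0 := by
    have hx : x - Q x ∈ LinearMap.ker (Q : H →ₗ[ℂ] H) := by
      change Q (x - Q x) = 0
      rw [map_sub, sub_eq_zero]
      exact (DFunLike.congr_fun hQ.1 x).symm
    rwa [hQ.2.2, ← hP.2.2] at hx
  ext x
  rw [← hPQ x, ← sub_eq_zero, ← map_sub, hker]

theorem IsEigenSubprojector.eigenspace_ne_bot {A : H →ₗ.[ℂ] H} {lam : ℂ} {P : H →L[ℂ] H}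
    (h : IsEigenSubprojector A lam P) : eigenspace A lam ≠ ⊥ := by
  intro hbot
  have hrange : P.range = ⊥ := le_bot_iff.1 (hbot ▸ h.range_le)
  exact h.ne_zero (ContinuousLinearMap.coe_injective (LinearMap.range_eq_bot.1 hrange))

/-- Near `x`, `G` is an analytic eigenvalue of multiplicity `m` paired with its eigenprojector.
At `x` itself other eigenvalues may cross it, and the projection may be onto a proper subspace of
the eigenspace. -/
structure IsBranchAt (T : ℂ → D →ₗ[ℂ] H) (m : ℕ) (G : ℂ → ℂ × (H →L[ℂ] H)) (x : ℂ) : Prop where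
  analyticAt : AnalyticAt ℂ G x
  isEigenSubprojector : ∀ᶠ z in 𝓝 x, IsEigenSubprojector ⟨D, T z⟩ (G z).1 (G z).2
  isEigenprojector : ∀ᶠ z in 𝓝[≠] x, IsEigenprojector ⟨D, T z⟩ (G z).1 (G z).2
  finrank_eq : ∀ᶠ z in 𝓝 x, finrank ℂ (G z).2.range = m

/-- Near `x`, `F` is the restriction to the real line of a branch. -/
def IsRealBranchAt (T : ℂ → D →ₗ[ℂ] H) (m : ℕ) (F : ℝ → ℂ × (H →L[ℂ] H)) (x : ℝ) : Prop :=
  ∃ G, IsBranchAt T m G x ∧ ∀ᶠ y : ℝ in 𝓝 x, F y = G y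

variable {T : ℂ → D →ₗ[ℂ] H} {m : ℕ}

theorem IsEigenSplittingAt.isBranchAt {ι : Type*} {z₀ lam₀ : ℂ} {l : ι → ℂ → ℂ}
    {p : ι → ℂ → H →L[ℂ] H} (h : IsEigenSplittingAt T z₀ lam₀ l p) {j : ι}
    (hm : finrank ℂ (p j z₀).range = m) : IsBranchAt T m (fun z => (l j z, p j z)) z₀ where
  analyticAt := (h.analyticAt_eigenvalue j).prod (h.analyticAt_proj j)
  isEigenSubprojector := h.isEigenSubprojector.mono fun _ hz => hz j
  isEigenprojector := by
    filter_upwards [h.isEigenprojector.filter_mono nhdsWithin_le_nhds, h.injective]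
      with z hz hinj
    exact hz j fun i hij => hinj.ne hij
  finrank_eq := h.finrank_eq.mono fun _ hz => (hz j).trans hm

namespace IsRealBranchAt

variable {F F' : ℝ → ℂ × (H →L[ℂ] H)} {x : ℝ}

theorem congr (h : IsRealBranchAt T m F x) (he : F' =ᶠ[𝓝 x] F) :
    IsRealBranchAt T m F' x := by
  obtain ⟨G, hG, hF⟩ := h
  exact ⟨G, hG, he.trans hF⟩

theorem analyticAt (h : IsRealBranchAt T m F x) : AnalyticAt ℝ F x := by
  obtain ⟨G, hG, hF⟩ := h
  exact (analyticAt_comp_ofReal hG.analyticAt).congr (EventuallyEq.symm hF)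

theorem isEigenSubprojector (h : IsRealBranchAt T m F x) :
    ∀ᶠ y : ℝ in 𝓝 x, IsEigenSubprojector ⟨D, T y⟩ (F y).1 (F y).2 := by
  obtain ⟨G, hG, hF⟩ := h
  filter_upwards [hF, eventually_ofReal hG.isEigenSubprojector] with y hFy hy
  rwa [hFy]

theorem isEigenprojector (h : IsRealBranchAt T m F x) :
    ∀ᶠ y : ℝ in 𝓝[≠] x, IsEigenprojector ⟨D, T y⟩ (F y).1 (F y).2 := by
  obtain ⟨G, hG, hF⟩ := h
  filter_upwards [hF.filter_mono nhdsWithin_le_nhds,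
    (tendsto_ofReal_nhdsNE x).eventually hG.isEigenprojector] with y hFy hy
  rwa [hFy]

theorem finrank_eq (h : IsRealBranchAt T m F x) : finrank ℂ (F x).2.range = m := by
  obtain ⟨G, hG, hF⟩ := h
  rw [hF.self_of_nhds]
  exact hG.finrank_eq.self_of_nhds

end IsRealBranchAt

namespace IsSymmetricPencil

variable {B : H →L[ℂ] H}

theorem ofReal_re_eigenvalue (hT : IsSymmetricPencil T B) {x : ℝ} {lam : ℂ}
    (h : eigenspace ⟨D, T x⟩ lam ≠ ⊥) : (lam.re : ℂ) = lam := by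
  obtain ⟨u, hu, hu₀⟩ := Submodule.exists_mem_ne_zero_of_ne_bot h
  obtain ⟨f, hf, rfl⟩ := mem_eigenspace_iff_exists.1 hu
  have hTf : T x f = lam • (f : H) := sub_eq_zero.1 hf
  have hsymm := hT.symm x f f
  rw [hTf, inner_smul_left, inner_smul_right] at hsymm
  exact Complex.conj_eq_iff_re.1 (mul_right_cancel₀ (inner_self_ne_zero.2 hu₀) hsymm)

/-- A finite-difference form of the Hellmann–Feynman formula. -/
theorem sub_mul_inner_eq (hT : IsSymmetricPencil T B) {x y : ℝ} {lam lam' : ℂ} {w u : H}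
    (hlam : (lam.re : ℂ) = lam) (hw : w ∈ eigenspace ⟨D, T x⟩ lam)
    (hu : u ∈ eigenspace ⟨D, T y⟩ lam') :
    (lam' - lam) * inner ℂ w u = (y - x) * inner ℂ w (B u) := by
  obtain ⟨f, hf, rfl⟩ := mem_eigenspace_iff_exists.1 hw
  obtain ⟨g, hg, rfl⟩ := mem_eigenspace_iff_exists.1 hu
  have hTf : T x f = lam • (f : H) := sub_eq_zero.1 hf
  have hTg : lam' • (g : H) = T x g + ((y : ℂ) - x) • B g :=
    (sub_eq_zero.1 hg).symm.trans (hT.apply_eq y x g)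
  have hsymm : lam * inner ℂ (f : H) (g : H) = inner ℂ (f : H) (T x g) := by
    rw [← hT.symm, hTf, inner_smul_left, Complex.conj_eq_iff_re.2 hlam]
  rw [sub_mul, hsymm, ← inner_smul_right, hTg, inner_add_right, inner_smul_right,
    add_sub_cancel_left]

theorem norm_slope_mul_norm_inner_le (hT : IsSymmetricPencil T B) {l : ℝ → ℂ} {x y : ℝ}
    (hxy : y ≠ x) (hlx : ((l x).re : ℂ) = l x) {w u : H}
    (hw : w ∈ eigenspace ⟨D, T x⟩ (l x)) (hu : u ∈ eigenspace ⟨D, T y⟩ (l y)) :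
    ‖slope l x y‖ * ‖inner ℂ w u‖ ≤ ‖w‖ * (‖B‖ * ‖u‖) := by
  have hne : (y : ℂ) - x ≠ 0 := sub_ne_zero.2 (Complex.ofReal_injective.ne hxy)
  have hslope : slope l x y * inner ℂ w u = inner ℂ w (B u) := by
    rw [slope_def_module, Complex.real_smul, mul_assoc, hT.sub_mul_inner_eq hlx hw hu,
      Complex.ofReal_inv, Complex.ofReal_sub, inv_mul_cancel_left₀ hne]
  rw [← norm_mul, hslope]
  exact (norm_inner_le_norm _ _).trans
    (mul_le_mul_of_nonneg_left (B.le_opNorm u) (norm_nonneg w))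

theorem norm_deriv_le (hT : IsSymmetricPencil T B) {F : ℝ → ℂ × (H →L[ℂ] H)} {x : ℝ}
    (hF : IsRealBranchAt T m F x) : ‖deriv (fun y => (F y).1) x‖ ≤ ‖B‖ := by
  have hderiv := (analyticAt_fst.comp hF.analyticAt).differentiableAt.hasDerivAt
  have hx := hF.isEigenSubprojector.self_of_nhds
  have hreal := hT.ofReal_re_eigenvalue hx.eigenspace_ne_bot
  obtain ⟨v, hv⟩ : ∃ v, (F x).2 v ≠ 0 := by
    by_contra! hzero
    exact hx.ne_zero (ContinuousLinearMap.ext hzero)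
  set w := (F x).2 v
  have hwF : w ∈ (F x).2.range := ⟨v, rfl⟩
  have hwpos : 0 < ‖w‖ := norm_pos_iff.2 hv
  have htend : Tendsto (fun y => (F y).2 w) (𝓝[≠] x) (𝓝 w) := by
    have hcont : ContinuousAt (fun y => (F y).2 w) x :=
      hF.analyticAt.continuousAt.snd.clm_apply continuousAt_const
    refine Tendsto.mono_left ?_ nhdsWithin_le_nhds
    simpa only [(mem_range_iff_apply_eq_self hx.isIdempotentElem).1 hwF] using hcont.tendsto
  have hle : ∀ᶠ y in 𝓝[≠] x, ‖slope (fun y => (F y).1) x y‖ * ‖inner ℂ w ((F y).2 w)‖ ≤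
      ‖w‖ * (‖B‖ * ‖(F y).2 w‖) := by
    filter_upwards [hF.isEigenSubprojector.filter_mono nhdsWithin_le_nhds, self_mem_nhdsWithin]
      with y hy hyx
    exact hT.norm_slope_mul_norm_inner_le hyx hreal (hx.range_le hwF) (hy.range_le ⟨w, rfl⟩)
  have hlim := le_of_tendsto_of_tendsto
    ((hasDerivAt_iff_tendsto_slope.1 hderiv).norm.mul (tendsto_const_nhds.inner htend).norm)
    ((htend.norm.const_mul ‖B‖).const_mul ‖w‖) hle
  have hinner : ‖(inner ℂ w w : ℂ)‖ = ‖w‖ * ‖w‖ := by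
    rw [inner_self_eq_norm_sq_to_K, norm_pow, RCLike.norm_ofReal, abs_norm, sq]
  rw [hinner, mul_left_comm] at hlim
  exact le_of_mul_le_mul_right (le_of_mul_le_mul_left hlim hwpos) hwpos

theorem exists_continuous_eigenvalue_eq (hT : IsSymmetricPencil T B)
    {F : ℝ → ℂ × (H →L[ℂ] H)} {J : Set ℝ} (hJ : J.OrdConnected)
    (hF : ∀ x ∈ J, IsRealBranchAt T m F x) :
    ∃ g : ℝ → ℝ, Continuous g ∧ ∀ x ∈ J, (F x).1 = g x := by
  have hlip : LipschitzOnWith ‖B‖₊ (fun y => (F y).1) J :=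
    hJ.convex.lipschitzOnWith_of_nnnorm_deriv_le
      (fun x hx => (analyticAt_fst.comp (hF x hx).analyticAt).differentiableAt)
      fun x hx => hT.norm_deriv_le (hF x hx)
  have hlip_re : LipschitzOnWith ‖B‖₊ (fun y => (F y).1.re) J := by
    refine LipschitzOnWith.of_dist_le_mul fun x hx y hy => ?_
    refine le_trans ?_ (hlip.dist_le_mul x hx y hy)
    rw [dist_eq_norm, dist_eq_norm, ← Complex.sub_re]
    exact Complex.abs_re_le_norm _
  obtain ⟨g, hg, hgF⟩ := hlip_re.extend_real
  refine ⟨g, hg.continuous, fun x hx => ?_⟩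
  rw [← hgF hx]
  exact (hT.ofReal_re_eigenvalue
    (hF x hx).isEigenSubprojector.self_of_nhds.eigenspace_ne_bot).symm

end IsSymmetricPencil

theorem IsRealBranchAt.exists_eventually_eq {F : ℝ → ℂ × (H →L[ℂ] H)} {x : ℝ} {ι : Type*}
    [Finite ι] {l : ι → ℂ → ℂ} {p : ι → ℂ → H →L[ℂ] H} (hF : IsRealBranchAt T m F x)
    (hl : ∀ j, ContinuousAt (l j) x) (hinj : Function.Injective (l · x))
    (hp : ∀ᶠ y : ℝ in 𝓝 x, ∀ j, IsEigenprojector ⟨D, T y⟩ (l j y) (p j y))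
    (hcover : ∀ᶠ y : ℝ in 𝓝 x, ∃ j, l j y = (F y).1) :
    ∃ j, ∀ᶠ y : ℝ in 𝓝[≠] x, F y = (l j y, p j y) := by
  obtain ⟨j, hj⟩ := hcover.self_of_nhds
  have hother : ∀ᶠ y : ℝ in 𝓝 x, ∀ i, i ≠ j → l i y ≠ (F y).1 := by
    refine eventually_all.2 fun i => eventually_imp_distrib_left.2 fun hij => ?_
    have hli : ContinuousAt (fun y : ℝ => l i y) x :=
      (hl i).comp Complex.continuous_ofReal.continuousAt
    exact (hli.ne_iff_eventually_ne hF.analyticAt.continuousAt.fst).1 (hj ▸ hinj.ne hij)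
  refine ⟨j, ?_⟩
  filter_upwards [hF.isEigenprojector, hother.filter_mono nhdsWithin_le_nhds,
    hp.filter_mono nhdsWithin_le_nhds, hcover.filter_mono nhdsWithin_le_nhds]
    with y hFy hne hpy ⟨i, hi⟩
  obtain rfl : i = j := of_not_not fun hij => hne i hij hi
  exact Prod.ext hi.symm ((hi.symm ▸ hFy).eq (hpy i))

variable [CompleteSpace H]

theorem IsBranchAt.eventually {G : ℂ → ℂ × (H →L[ℂ] H)} {x : ℂ} (h : IsBranchAt T m G x) :
    ∀ᶠ y in 𝓝 x, IsBranchAt T m G y := by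
  filter_upwards [h.analyticAt.eventually_analyticAt, h.isEigenSubprojector.eventually_nhds,
    eventually_nhds_eventually_nhdsNE h.isEigenprojector, h.finrank_eq.eventually_nhds]
    with y hy₁ hy₂ hy₃ hy₄
  exact ⟨hy₁, hy₂, hy₃, hy₄⟩

theorem IsEigenSplittingAt.eventually_real {ι : Type*} [Finite ι] {e : ℝ} {lam₀ : ℂ}
    {l : ι → ℂ → ℂ} {p : ι → ℂ → H →L[ℂ] H} (h : IsEigenSplittingAt T e lam₀ l p) :
    ∀ᶠ y : ℝ in 𝓝[≠] e, (∀ j, AnalyticAt ℂ (l j) y ∧ AnalyticAt ℂ (p j) y) ∧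
      Function.Injective (l · (y : ℂ)) ∧
      (∀ j, IsEigenprojector ⟨D, T y⟩ (l j y) (p j y)) ∧
      ∀ j, finrank ℂ (p j y).range = finrank ℂ (p j e).range := by
  have han : ∀ᶠ z in 𝓝 (e : ℂ), ∀ j, AnalyticAt ℂ (l j) z ∧ AnalyticAt ℂ (p j) z :=
    eventually_all.2 fun j => (h.analyticAt_eigenvalue j).eventually_analyticAt.and
      (h.analyticAt_proj j).eventually_analyticAt
  have hall : ∀ᶠ z in 𝓝[≠] (e : ℂ), (∀ j, AnalyticAt ℂ (l j) z ∧ AnalyticAt ℂ (p j) z) ∧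
      Function.Injective (l · z) ∧ (∀ j, IsEigenprojector ⟨D, T z⟩ (l j z) (p j z)) ∧
      ∀ j, finrank ℂ (p j z).range = finrank ℂ (p j e).range := by
    filter_upwards [han.filter_mono nhdsWithin_le_nhds, h.injective,
      h.isEigenprojector.filter_mono nhdsWithin_le_nhds,
      h.finrank_eq.filter_mono nhdsWithin_le_nhds] with z hz hinj hp hfin
    exact ⟨hz, hinj, fun j => hp j fun i hij => hinj.ne hij, hfin⟩
  exact (tendsto_ofReal_nhdsNE e).eventually hall

namespace IsSymmetricPencil

variable {B : H →L[ℂ] H}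

/-- The eigenvalue has a limit at `e` because it is Lipschitz. The splitting of the spectrum at
that limit then has a component that continues the branch across `e`. -/
theorem exists_isBranchAt_of_mem_closure (hT : IsSymmetricPencil T B) {F : ℝ → ℂ × (H →L[ℂ] H)}
    {J : Set ℝ} (hJo : IsOpen J) (hJc : J.OrdConnected) (hF : ∀ x ∈ J, IsRealBranchAt T m F x)
    {e : ℝ} (hdisc : HasDiscreteSpectrum ⟨D, T e⟩) (he : e ∈ closure J) (heJ : e ∉ J) :
    ∃ G, IsBranchAt T m G e ∧ ∀ᶠ y : ℝ in 𝓝 e, y ∈ J → F y = G y := by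
  obtain ⟨g, hgc, hg⟩ := hT.exists_continuous_eigenvalue_eq hJc hF
  obtain ⟨ι, _, l, p, hs⟩ := hT.exists_isEigenSplittingAt hdisc (g e)
  have hexhaust : ∀ᶠ y : ℝ in 𝓝 e, eigenspace ⟨D, T y⟩ (g y : ℂ) ≠ ⊥ → ∃ j, l j y = g y := by
    have hc : ContinuousAt (fun y : ℝ => ((y : ℂ), (g y : ℂ))) e := by fun_prop
    exact hc.eventually hs.exhausts
  obtain ⟨r, hr, hball⟩ := Metric.eventually_nhds_iff_ball.1
    ((eventually_nhdsWithin_iff.1 hs.eventually_real).and hexhaust)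
  set J' := J ∩ Metric.ball e r
  have hJ'o : IsOpen J' := hJo.inter Metric.isOpen_ball
  have hJ'c : IsPreconnected J' :=
    (hJc.convex.inter (convex_ball e r)).isPreconnected
  have hgood := fun y (hy : y ∈ J') => (hball y hy.2).1 (ne_of_mem_of_not_mem hy.1 heJ)
  have hcover : ∀ y ∈ J', ∃ j, l j y = (F y).1 := by
    intro y hy
    have hbot := (hF y hy.1).isEigenSubprojector.self_of_nhds.eigenspace_ne_bot
    rw [hg y hy.1] at hbot ⊢
    exact (hball y hy.2).2 hbot
  obtain ⟨y₀, hy₀b, hy₀J⟩ := mem_closure_iff.1 he _ Metric.isOpen_ball (Metric.mem_ball_self hr)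
  have hy₀ : y₀ ∈ J' := ⟨hy₀J, hy₀b⟩
  obtain ⟨j, hj⟩ := (hF y₀ hy₀J).exists_eventually_eq
    (fun j => ((hgood y₀ hy₀).1 j).1.continuousAt) (hgood y₀ hy₀).2.1
    (eventually_of_mem (hJ'o.mem_nhds hy₀) fun y hy => (hgood y hy).2.2.1)
    (eventually_of_mem (hJ'o.mem_nhds hy₀) hcover)
  have heq : Set.EqOn F (fun y : ℝ => (l j y, p j y)) J' := by
    refine AnalyticOnNhd.eqOn_of_preconnected_of_frequently_eq (𝕜 := ℝ)
      (fun x hx => (hF x hx.1).analyticAt) (fun x hx => ?_) hJ'c hy₀ hj.frequently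
    obtain ⟨hlx, hpx⟩ := (hgood x hx).1 j
    exact analyticAt_comp_ofReal (hlx.prod hpx)
  refine ⟨_, hs.isBranchAt (j := j) ?_, ?_⟩
  · rw [← (hgood y₀ hy₀).2.2.2 j, ← (hF y₀ hy₀J).finrank_eq, heq hy₀]
  · exact eventually_of_mem (Metric.ball_mem_nhds e hr) fun y hyr hyJ => heq ⟨hyJ, hyr⟩

theorem exists_isBranchAt_of_constant_multiplicity (hT : IsSymmetricPencil T B) {x : ℝ}
    (hdisc : HasDiscreteSpectrum ⟨D, T x⟩) {μ : ℝ → ℝ} (hμ : ContinuousAt μ x)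
    (hm : ∀ᶠ y : ℝ in 𝓝 x, IsEigenvalueOfMultiplicity ⟨D, T y⟩ (μ y) m) :
    ∃ G, IsBranchAt T m G x ∧
      ∀ᶠ y : ℝ in 𝓝 x, (G y).1 = μ y ∧ IsEigenprojector ⟨D, T y⟩ (μ y) (G y).2 := by
  obtain ⟨ι, _, l, p, hs⟩ := hT.exists_isEigenSplittingAt hdisc (μ x)
  have hcover : ∀ᶠ y : ℝ in 𝓝 x, ∃ j, l j y = μ y := by
    have hc : ContinuousAt (fun y : ℝ => ((y : ℂ), (μ y : ℂ))) x := by fun_prop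
    filter_upwards [hc.eventually hs.exhausts, hm] with y hy ⟨hm₀, hmy⟩
    refine hy fun hbot => hm₀ ?_
    rw [← hmy, hbot, finrank_bot]
  obtain ⟨y, ⟨-, -, hp, hfin⟩, ⟨j, hj⟩, hmy⟩ := (hs.eventually_real.and
    ((hcover.and hm).filter_mono nhdsWithin_le_nhds)).exists
  have hrank : finrank ℂ (p j x).range = m := by
    rw [← hfin j, ← hmy.2, ← hj, ← (hp j).2.1]
  have huniq : ∀ i, i = j := hs.unique j (hrank.trans hm.self_of_nhds.2.symm)
  refine ⟨_, hs.isBranchAt hrank, ?_⟩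
  filter_upwards [hcover, eventually_ofReal hs.isEigenprojector] with y ⟨i, hi⟩ hy
  obtain rfl := huniq i
  exact ⟨hi, hi ▸ hy i fun k hk => absurd (huniq k) hk⟩

end IsSymmetricPencil

end UnboundedOp

end Branches

section Continuation

theorem exists_forall_eqOn {ι α β : Type*} [Nonempty ι] {s : ι → Set α} {f : ι → α → β}
    (h : ∀ i j, Set.EqOn (f i) (f j) (s i ∩ s j)) : ∃ g : α → β, ∀ i, Set.EqOn g (f i) (s i) := by
  have hmem : ∀ y ∈ ⋃ i, s i, ∃ i, y ∈ s i := fun y => Set.mem_iUnion.1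
  choose! c hc using hmem
  exact ⟨fun y => f (c y) y, fun i y hy => h _ _ ⟨hc y (Set.mem_iUnion_of_mem i hy), hy⟩⟩

variable {E : Type*} [NormedAddCommGroup E] [NormedSpace ℝ E]

/-- A local property `p F x` of a function `F` near the point `x` of the real line that implies
analyticity and that continues across the endpoints of open intervals. -/
structure IsContinuable (p : (ℝ → E) → ℝ → Prop) : Prop where
  analyticAt {F : ℝ → E} {x : ℝ} : p F x → AnalyticAt ℝ F x
  congr {F F' : ℝ → E} {x : ℝ} : p F x → F' =ᶠ[𝓝 x] F → p F' x
  continues {F : ℝ → E} {J : Set ℝ} {e : ℝ} : IsOpen J → IsPreconnected J → (∀ x ∈ J, p F x) →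
    e ∈ closure J → e ∉ J → ∃ G, (∀ᶠ y in 𝓝 e, p G y) ∧ ∀ᶠ y in 𝓝 e, y ∈ J → F y = G y

namespace IsContinuable

variable {p : (ℝ → E) → ℝ → Prop} {F F' : ℝ → E} {J : Set ℝ} {x₀ : ℝ}

theorem eqOn (hp : IsContinuable p) (hJ : IsPreconnected J) (hF : ∀ x ∈ J, p F x)
    (hF' : ∀ x ∈ J, p F' x) (hx₀ : x₀ ∈ J) (he : F =ᶠ[𝓝 x₀] F') : Set.EqOn F F' J :=
  AnalyticOnNhd.eqOn_of_preconnected_of_eventuallyEq (𝕜 := ℝ)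
    (fun x hx => hp.analyticAt (hF x hx)) (fun x hx => hp.analyticAt (hF' x hx)) hJ hx₀ he

theorem exists_extension (hp : IsContinuable p) (hJo : IsOpen J) (hJ : IsPreconnected J)
    (hF : ∀ x ∈ J, p F x) {e : ℝ} (he : e ∈ closure J) :
    ∃ r > 0, ∃ F', (∀ x ∈ J ∪ Metric.ball e r, p F' x) ∧ Set.EqOn F' F J := by
  classical
  by_cases heJ : e ∈ J
  · obtain ⟨r, hr, hball⟩ := Metric.isOpen_iff.1 hJo e heJ
    exact ⟨r, hr, F, fun x hx => hF x (hx.elim id (hball ·)), Set.eqOn_refl F J⟩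
  obtain ⟨G, hG, hFG⟩ := hp.continues hJo hJ hF he heJ
  obtain ⟨r, hr, hball⟩ := Metric.eventually_nhds_iff_ball.1 (hG.and hFG)
  have hG' : Set.EqOn (J.piecewise F G) G (Metric.ball e r) := by
    intro y hy
    by_cases hyJ : y ∈ J
    · rw [Set.piecewise_eq_of_mem _ _ _ hyJ, (hball y hy).2 hyJ]
    · exact Set.piecewise_eq_of_notMem _ _ _ hyJ
  refine ⟨r, hr, J.piecewise F G, ?_, Set.piecewise_eqOn J F G⟩
  rintro x (hx | hx)
  · exact hp.congr (hF x hx) ((Set.piecewise_eqOn J F G).eventuallyEq_of_mem (hJo.mem_nhds hx))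
  · exact hp.congr (hball x hx).1 (hG'.eventuallyEq_of_mem (Metric.isOpen_ball.mem_nhds hx))

theorem exists_glue (hp : IsContinuable p) {F₀ : ℝ → E} {𝒥 : Set (Set ℝ)} (hne : 𝒥.Nonempty)
    (h𝒥 : ∀ J ∈ 𝒥, IsOpen J ∧ IsPreconnected J ∧ x₀ ∈ J)
    (hF : ∀ J ∈ 𝒥, ∃ F, (∀ x ∈ J, p F x) ∧ F =ᶠ[𝓝 x₀] F₀) :
    ∃ F, (∀ x ∈ ⋃₀ 𝒥, p F x) ∧ F =ᶠ[𝓝 x₀] F₀ := by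
  have := hne.to_subtype
  choose! K hK hK₀ using hF
  have hinter (I J : 𝒥) : Set.EqOn (K I) (K J) (I ∩ J : Set ℝ) := by
    obtain ⟨-, hI, hx₀I⟩ := h𝒥 I I.2
    obtain ⟨-, hJ, hx₀J⟩ := h𝒥 J J.2
    exact hp.eqOn (hI.ordConnected.inter hJ.ordConnected).isPreconnected
      (fun x hx => hK I I.2 x hx.1) (fun x hx => hK J J.2 x hx.2) ⟨hx₀I, hx₀J⟩
      ((hK₀ I I.2).trans (hK₀ J J.2).symm)
  obtain ⟨F, hF⟩ := exists_forall_eqOn hinter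
  have hFK (J : 𝒥) {x : ℝ} (hx : x ∈ (J : Set ℝ)) : F =ᶠ[𝓝 x] K J :=
    (hF J).eventuallyEq_of_mem ((h𝒥 J J.2).1.mem_nhds hx)
  refine ⟨F, fun x ⟨J, hJ, hx⟩ => hp.congr (hK J hJ x hx) (hFK ⟨J, hJ⟩ hx), ?_⟩
  obtain ⟨J, hJ⟩ := hne
  exact (hFK ⟨J, hJ⟩ (h𝒥 J hJ).2.2).trans (hK₀ J hJ)

theorem exists_forall (hp : IsContinuable p) {F₀ : ℝ → E} (hF₀ : ∀ᶠ x in 𝓝 x₀, p F₀ x) :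
    ∃ F, (∀ x, p F x) ∧ F =ᶠ[𝓝 x₀] F₀ := by
  set 𝒥 : Set (Set ℝ) := {J | (IsOpen J ∧ IsPreconnected J ∧ x₀ ∈ J) ∧
    ∃ F, (∀ x ∈ J, p F x) ∧ F =ᶠ[𝓝 x₀] F₀}
  obtain ⟨r, hr, hball⟩ := Metric.eventually_nhds_iff_ball.1 hF₀
  have hr𝒥 : Metric.ball x₀ r ∈ 𝒥 :=
    ⟨⟨Metric.isOpen_ball, (convex_ball x₀ r).isPreconnected, Metric.mem_ball_self hr⟩,
      F₀, hball, .rfl⟩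
  obtain ⟨F, hF, hFF₀⟩ := hp.exists_glue ⟨_, hr𝒥⟩ (fun J hJ => hJ.1) fun J hJ => hJ.2
  have hopen : IsOpen (⋃₀ 𝒥) := isOpen_sUnion fun J hJ => hJ.1.1
  have hconn : IsPreconnected (⋃₀ 𝒥) :=
    isPreconnected_sUnion x₀ 𝒥 (fun J hJ => hJ.1.2.2) fun J hJ => hJ.1.2.1
  have hx₀ : x₀ ∈ ⋃₀ 𝒥 := ⟨_, hr𝒥, Metric.mem_ball_self hr⟩
  have hclosed : IsClosed (⋃₀ 𝒥) := by
    refine isClosed_of_closure_subset fun e he => ?_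
    obtain ⟨r, hr, F', hF', hFF'⟩ := hp.exists_extension hopen hconn hF he
    have hmeet : (⋃₀ 𝒥 ∩ Metric.ball e r).Nonempty :=
      Set.inter_comm _ _ ▸ mem_closure_iff.1 he _ Metric.isOpen_ball (Metric.mem_ball_self hr)
    refine ⟨⋃₀ 𝒥 ∪ Metric.ball e r, ⟨⟨hopen.union Metric.isOpen_ball, ?_, .inl hx₀⟩, F', hF', ?_⟩,
      .inr (Metric.mem_ball_self hr)⟩
    · exact hconn.union' hmeet (convex_ball e r).isPreconnected
    · exact (hFF'.eventuallyEq_of_mem (hopen.mem_nhds hx₀)).trans hFF₀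
  have huniv : ⋃₀ 𝒥 = Set.univ := IsClopen.eq_univ ⟨hclosed, hopen⟩ ⟨x₀, hx₀⟩
  exact ⟨F, fun x => hF x (huniv ▸ Set.mem_univ x), hFF₀⟩

end IsContinuable

theorem UnboundedOp.IsSymmetricPencil.isContinuable_isRealBranchAt {H : Type*}
    [NormedAddCommGroup H] [InnerProductSpace ℂ H] [CompleteSpace H] {D : Submodule ℂ H}
    {T : ℂ → D →ₗ[ℂ] H} {B : H →L[ℂ] H} (hT : IsSymmetricPencil T B)
    (hdisc : ∀ x : ℝ, HasDiscreteSpectrum ⟨D, T x⟩) (m : ℕ) :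
    IsContinuable (IsRealBranchAt T m) where
  analyticAt := IsRealBranchAt.analyticAt
  congr := IsRealBranchAt.congr
  continues hJo hJ hF he heJ := by
    obtain ⟨G, hG, hFG⟩ :=
      hT.exists_isBranchAt_of_mem_closure hJo hJ.ordConnected hF (hdisc _) he heJ
    exact ⟨fun y => G y,
      (eventually_ofReal hG.eventually).mono fun y hy => ⟨G, hy, EventuallyEq.rfl⟩, hFG⟩

end Continuation

section Connectedness

variable {E : Type*} [NormedAddCommGroup E] [NormedSpace ℝ E]

theorem isPreconnected_ball_sdiff_singleton (hE : 1 < Module.rank ℝ E) (x : E) (r : ℝ) :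
    IsPreconnected (Metric.ball x r \ {x}) := by
  have hpolar : Metric.ball x r \ {x} =
      (fun q : ℝ × E => x + q.1 • q.2) '' (Set.Ioo 0 r ×ˢ Metric.sphere 0 1) := by
    ext z
    constructor
    · rintro ⟨hz, hzx⟩
      have hpos : 0 < ‖z - x‖ := norm_pos_iff.2 (sub_ne_zero.2 hzx)
      refine ⟨(‖z - x‖, ‖z - x‖⁻¹ • (z - x)), ⟨⟨hpos, mem_ball_iff_norm.1 hz⟩, ?_⟩, ?_⟩
      · rw [mem_sphere_zero_iff_norm, norm_smul, norm_inv, norm_norm, inv_mul_cancel₀ hpos.ne']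
      · simp only [smul_inv_smul₀ hpos.ne', add_sub_cancel]
    · rintro ⟨⟨ρ, u⟩, ⟨⟨hρ, hρr⟩, hu⟩, rfl⟩
      have hnorm : ‖ρ • u‖ = ρ := by
        rw [norm_smul, mem_sphere_zero_iff_norm.1 hu, mul_one, Real.norm_of_nonneg hρ.le]
      refine ⟨?_, ?_⟩
      · rwa [mem_ball_iff_norm, add_sub_cancel_left, hnorm]
      · rw [Set.mem_singleton_iff, add_eq_left, ← norm_eq_zero, hnorm]
        exact hρ.ne'
  rw [hpolar]
  exact (isPreconnected_Ioo.prod (isPreconnected_sphere hE 0 1)).image _ (by fun_prop)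

theorem isPreconnected_ball_sdiff (hE : 1 < Module.rank ℝ E) {S : Set E} {x : E} {r : ℝ}
    (hS : ∀ y ∈ Metric.ball x r, y ∈ S → y = x) : IsPreconnected (Metric.ball x r \ S) := by
  by_cases hx : x ∈ S
  · have hinter : Metric.ball x r \ S = Metric.ball x r \ {x} := by
      refine Set.ext fun y => and_congr_right fun hy => not_congr ⟨hS y hy, ?_⟩
      rintro rfl
      exact hx
    rw [hinter]
    exact isPreconnected_ball_sdiff_singleton hE x r
  · have hdisj : Disjoint (Metric.ball x r) S :=
      Set.disjoint_left.2 fun y hy hyS => hx (hS y hy hyS ▸ hyS)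
    rw [hdisj.sdiff_eq_left]
    exact (convex_ball x r).isPreconnected

theorem isPreconnected_sdiff_of_eventually_notMem (hE : 1 < Module.rank ℝ E) {V S : Set E}
    (hVo : IsOpen V) (hV : IsPreconnected V) (hS : ∀ x ∈ V, ∀ᶠ y in 𝓝[≠] x, y ∉ S) :
    IsPreconnected (V \ S) := by
  have : Nontrivial E := rank_pos_iff_nontrivial.1 (zero_lt_one.trans hE)
  have : PreconnectedSpace V := isPreconnected_iff_preconnectedSpace.1 hV
  have hball (x : V) : ∃ r > 0, ∀ y ∈ Metric.ball (x : E) r, y ∈ V ∧ (y ∈ S → y = x) := by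
    refine Metric.eventually_nhds_iff_ball.1 ((hVo.eventually_mem x.2).and ?_)
    filter_upwards [eventually_nhdsWithin_iff.1 (hS x x.2)] with y hy
    exact not_imp_not.1 hy
  choose r hr hball using hball
  set W : V → Set E := fun x => Metric.ball (x : E) (r x) \ S
  have hnear (x : V) : ∀ᶠ y in 𝓝 x, (W x ∩ W y).Nonempty ∧ (W y ∩ W x).Nonempty := by
    filter_upwards [continuous_subtype_val.continuousAt.eventually
      (Metric.ball_mem_nhds (x : E) (hr x))] with y hy
    obtain ⟨z, hzS, hzx, hzy⟩ := ((hS y y.2).and (nhdsWithin_le_nhds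
      ((Metric.isOpen_ball.eventually_mem hy).and (Metric.ball_mem_nhds (y : E) (hr y))))).exists
    exact ⟨⟨z, ⟨hzx, hzS⟩, ⟨hzy, hzS⟩⟩, ⟨z, ⟨hzy, hzS⟩, ⟨hzx, hzS⟩⟩⟩
  have hcover : V \ S = ⋃ x, W x := by
    ext z
    rw [Set.mem_iUnion]
    exact ⟨fun hz => ⟨⟨z, hz.1⟩, Metric.mem_ball_self (hr _), hz.2⟩,
      fun ⟨x, hzx, hzS⟩ => ⟨(hball x z hzx).1, hzS⟩⟩
  rw [hcover]
  refine IsPreconnected.iUnion_of_reflTransGen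
    (fun x => isPreconnected_ball_sdiff hE fun y hy => (hball x y hy).2) fun x y => ?_
  refine PreconnectedSpace.induction₂' _ (fun x => ?_) ⟨fun _ _ _ => .trans⟩ x y
  exact (hnear x).mono fun y hy => ⟨.single hy.1, .single hy.2⟩

end Connectedness

section Complexification

theorem isPreconnected_iUnion_ball_ofReal {r : ℝ → ℝ} (hr : ∀ x, 0 < r x) :
    IsPreconnected (⋃ x : ℝ, Metric.ball (x : ℂ) (r x)) := by
  have hline : IsPreconnected (Set.range ((↑) : ℝ → ℂ)) :=
    isPreconnected_range Complex.continuous_ofReal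
  have hunion : ⋃ x : ℝ, Metric.ball (x : ℂ) (r x) =
      ⋃ x : ℝ, Set.range ((↑) : ℝ → ℂ) ∪ Metric.ball (x : ℂ) (r x) := by
    rw [← Set.union_iUnion, Set.union_eq_right.2]
    rintro _ ⟨x, rfl⟩
    exact Set.mem_iUnion.2 ⟨x, Metric.mem_ball_self (hr x)⟩
  rw [hunion]
  exact isPreconnected_iUnion ⟨((0 : ℝ) : ℂ), Set.mem_iInter.2 fun x => .inl ⟨0, rfl⟩⟩
    fun x => hline.union (x : ℂ) ⟨x, rfl⟩ (Metric.mem_ball_self (hr x))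
      (convex_ball _ _).isPreconnected

theorem ofReal_re_mem_ball {z : ℂ} {x r : ℝ} (hz : z ∈ Metric.ball (x : ℂ) r) :
    (z.re : ℂ) ∈ Metric.ball (x : ℂ) r := by
  rw [mem_ball_iff_norm, ← Complex.ofReal_sub, Complex.norm_real]
  exact (Complex.abs_re_le_norm (z - x)).trans_lt (mem_ball_iff_norm.1 hz)

theorem exists_eqOn_ball_ofReal {E : Type*} [NormedAddCommGroup E] [NormedSpace ℂ E] {r : ℝ → ℝ}
    {F : ℝ → E} {G : ℝ → ℂ → E}
    (hG : ∀ x, AnalyticOnNhd ℂ (G x) (Metric.ball (x : ℂ) (r x)))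
    (hFG : ∀ x y : ℝ, (y : ℂ) ∈ Metric.ball (x : ℂ) (r x) → F y = G x y) :
    ∃ K : ℂ → E, ∀ x, Set.EqOn K (G x) (Metric.ball (x : ℂ) (r x)) := by
  refine exists_forall_eqOn fun x x' z hz => ?_
  set W := Metric.ball (x : ℂ) (r x) ∩ Metric.ball (x' : ℂ) (r x')
  have hre : (z.re : ℂ) ∈ W := ⟨ofReal_re_mem_ball hz.1, ofReal_re_mem_ball hz.2⟩
  have hreal : ∀ᶠ y : ℝ in 𝓝[≠] z.re, G x y = G x' y := by
    have hWo : IsOpen W := Metric.isOpen_ball.inter Metric.isOpen_ball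
    filter_upwards [(eventually_ofReal (hWo.eventually_mem hre)).filter_mono nhdsWithin_le_nhds]
      with y hy
    rw [← hFG x y hy.1, hFG x' y hy.2]
  exact AnalyticOnNhd.eqOn_of_preconnected_of_frequently_eq (fun w hw => hG x w hw.1)
    (fun w hw => hG x' w hw.2) ((convex_ball _ _).inter (convex_ball _ _)).isPreconnected hre
    ((tendsto_ofReal_nhdsNE z.re).frequently hreal.frequently) hz

namespace UnboundedOp

variable {H : Type*} [NormedAddCommGroup H] [InnerProductSpace ℂ H] {D : Submodule ℂ H}
  {T : ℂ → D →ₗ[ℂ] H} {m : ℕ}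

theorem IsBranchAt.congr {G G' : ℂ → ℂ × (H →L[ℂ] H)} {x : ℂ} (h : IsBranchAt T m G x)
    (he : G' =ᶠ[𝓝 x] G) : IsBranchAt T m G' x where
  analyticAt := h.analyticAt.congr he.symm
  isEigenSubprojector := by
    filter_upwards [h.isEigenSubprojector, he] with z hz hGz
    rwa [hGz]
  isEigenprojector := by
    filter_upwards [h.isEigenprojector, he.filter_mono nhdsWithin_le_nhds] with z hz hGz
    rwa [hGz]
  finrank_eq := by
    filter_upwards [h.finrank_eq, he] with z hz hGz
    rwa [hGz]

theorem isClosed_and_discreteTopology_not_isEigenprojector {F : ℝ → ℂ × (H →L[ℂ] H)}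
    (hF : ∀ x, IsRealBranchAt T m F x) :
    IsClosed {x : ℝ | ¬ IsEigenprojector ⟨D, T x⟩ (F x).1 (F x).2} ∧
      DiscreteTopology {x : ℝ | ¬ IsEigenprojector ⟨D, T x⟩ (F x).1 (F x).2} := by
  rw [← isDiscrete_iff_discreteTopology, isClosed_and_discrete_iff]
  intro x
  rw [disjoint_principal_right]
  filter_upwards [(hF x).isEigenprojector] with y hy using not_not.2 hy

variable [CompleteSpace H]

theorem IsRealBranchAt.exists_ball {F : ℝ → ℂ × (H →L[ℂ] H)} {x : ℝ}
    (hF : IsRealBranchAt T m F x) :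
    ∃ (G : ℂ → ℂ × (H →L[ℂ] H)) (r : ℝ), 0 < r ∧
      (∀ z ∈ Metric.ball (x : ℂ) r, IsBranchAt T m G z) ∧
      ∀ y : ℝ, (y : ℂ) ∈ Metric.ball (x : ℂ) r → F y = G y := by
  obtain ⟨G, hG, hFG⟩ := hF
  have hre : ∀ᶠ z in 𝓝 (x : ℂ), F z.re = G z.re :=
    (Complex.continuous_re.tendsto' (x : ℂ) x (Complex.ofReal_re x)).eventually hFG
  obtain ⟨r, hr, hball⟩ := Metric.eventually_nhds_iff_ball.1 (hG.eventually.and hre)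
  exact ⟨G, r, hr, fun z hz => (hball z hz).1, fun y hy => (hball y hy).2⟩

theorem exists_isBranchAt_of_isRealBranchAt {F : ℝ → ℂ × (H →L[ℂ] H)}
    (hF : ∀ x, IsRealBranchAt T m F x) :
    ∃ (V : Set ℂ) (K : ℂ → ℂ × (H →L[ℂ] H)), IsOpen V ∧ IsPreconnected V ∧
      (∀ x : ℝ, (x : ℂ) ∈ V) ∧ (∀ x : ℝ, K x = F x) ∧ ∀ z ∈ V, IsBranchAt T m K z := by
  choose G r hr hG hFG using fun x => (hF x).exists_ball
  obtain ⟨K, hK⟩ := exists_eqOn_ball_ofReal (fun x z hz => (hG x z hz).analyticAt) hFG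
  have hcentre (x : ℝ) : (x : ℂ) ∈ Metric.ball (x : ℂ) (r x) := Metric.mem_ball_self (hr x)
  refine ⟨⋃ x : ℝ, Metric.ball (x : ℂ) (r x), K, isOpen_iUnion fun x => Metric.isOpen_ball,
    isPreconnected_iUnion_ball_ofReal hr, fun x => Set.mem_iUnion.2 ⟨x, hcentre x⟩,
    fun x => by rw [hK x (hcentre x), hFG x x (hcentre x)], fun z hz => ?_⟩
  obtain ⟨x, hzx⟩ := Set.mem_iUnion.1 hz
  exact (hG x z hzx).congr ((hK x).eventuallyEq_of_mem (Metric.isOpen_ball.mem_nhds hzx))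

theorem exists_isConnected_isEigenprojector {F : ℝ → ℂ × (H →L[ℂ] H)}
    (hF : ∀ x, IsRealBranchAt T m F x) :
    ∃ (U : Set ℂ) (K : ℂ → ℂ × (H →L[ℂ] H)), IsOpen U ∧ IsConnected U ∧
      (∀ x : ℝ, (x : ℂ) ∈ U ↔ IsEigenprojector ⟨D, T x⟩ (F x).1 (F x).2) ∧
      (∀ x : ℝ, K x = F x) ∧ AnalyticOnNhd ℂ K U ∧
      ∀ z ∈ U, IsEigenprojector ⟨D, T z⟩ (K z).1 (K z).2 ∧
        Module.finrank ℂ (K z).2.range = m := by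
  obtain ⟨V, K, hVo, hV, hRV, hKF, hK⟩ := exists_isBranchAt_of_isRealBranchAt hF
  set S : Set ℂ := {z | ¬ IsEigenprojector ⟨D, T z⟩ (K z).1 (K z).2}
  have hS : ∀ z ∈ V, ∀ᶠ w in 𝓝[≠] z, w ∉ S := fun z hz =>
    (hK z hz).isEigenprojector.mono fun _ => not_not.2
  have hreal (x : ℝ) : (x : ℂ) ∈ V \ S ↔ IsEigenprojector ⟨D, T x⟩ (F x).1 (F x).2 := by
    simp only [S, Set.mem_sdiff, hRV, Set.mem_ofPred_eq, not_not, hKF, true_and]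
  refine ⟨V \ S, K, isOpen_iff_mem_nhds.2 fun z hz => ?_, ⟨?_, ?_⟩, hreal, hKF,
    fun z hz => (hK z hz.1).analyticAt,
    fun z hz => ⟨not_not.1 hz.2, (hK z hz.1).finrank_eq.self_of_nhds⟩⟩
  · filter_upwards [hVo.mem_nhds hz.1, eventually_nhdsWithin_iff.1 (hS z hz.1)] with w hwV hw
    rcases eq_or_ne w z with rfl | hwz
    exacts [hz, ⟨hwV, hw hwz⟩]
  · obtain ⟨x, hx⟩ := (hF 0).isEigenprojector.exists
    exact ⟨x, (hreal x).2 hx⟩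
  · exact isPreconnected_sdiff_of_eventually_notMem
      (Complex.rank_real_complex ▸ Nat.one_lt_ofNat) hVo hV hS

end UnboundedOp

end Complexification

section Liouville

namespace UnboundedOp

variable {H : Type*} [NormedAddCommGroup H] [InnerProductSpace ℂ H] {D : Submodule ℂ H}

theorem HasOpDerivAt.eq_of_norm_le {T T' : ℂ → D →ₗ[ℂ] H} {C : ℝ}
    (hd : ∀ z, HasOpDerivAt T (T' z) z) (hb : ∀ z f, ‖T' z f‖ ≤ C * ‖f‖) (z w : ℂ) :
    T' z = T' w := by
  ext f
  refine ext_inner_left ℂ fun g => ?_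
  have hdiff : Differentiable ℂ (fun v => inner ℂ g (T v f)) := fun v => (hd v f g).differentiableAt
  have hderiv : deriv (fun v => inner ℂ g (T v f)) = fun v => inner ℂ g (T' v f) :=
    funext fun v => (hd v f g).deriv
  have hdiff' : Differentiable ℂ (fun v => inner ℂ g (T' v f)) :=
    hderiv ▸ (hdiff.contDiff (n := 2)).differentiable_deriv_two
  refine hdiff'.apply_eq_apply_of_bounded
    (isBounded_iff_forall_norm_le.2 ⟨‖g‖ * (C * ‖f‖), ?_⟩) z w
  rintro _ ⟨v, rfl⟩
  exact (norm_inner_le_norm _ _).trans (mul_le_mul_of_nonneg_left (hb v f) (norm_nonneg g))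

theorem HasOpDerivAt.apply_eq_add_smul {T : ℂ → D →ₗ[ℂ] H} {L : D →ₗ[ℂ] H}
    (hd : ∀ z, HasOpDerivAt T L z) (z w : ℂ) (f : D) : T z f = T w f + (z - w) • L f := by
  refine ext_inner_left ℂ fun g => ?_
  have hzero (v : ℂ) :
      HasDerivAt (fun v => inner ℂ g (T v f) - v * inner ℂ g (L f)) 0 v := by
    have := (hd v f g).fun_sub ((hasDerivAt_id v).mul_const (inner ℂ g (L f)))
    rwa [one_mul, sub_self] at this
  have hconst := is_const_of_deriv_eq_zero (fun v => (hzero v).differentiableAt)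
    (fun v => (hzero v).deriv) z w
  rw [inner_add_right, inner_smul_right]
  linear_combination hconst

variable [CompleteSpace H]

theorem exists_isSymmetricPencil (hD : Dense (D : Set H)) {T : ℂ → D →ₗ[ℂ] H}
    (hsa : ∀ x : ℝ, IsSelfAdjoint (LinearPMap.mk D (T x))) {C : ℝ}
    (hderiv : ∀ z : ℂ, ∃ T' : D →ₗ[ℂ] H, HasOpDerivAt T T' z ∧ ∀ f : D, ‖T' f‖ ≤ C * ‖f‖) :
    ∃ B : H →L[ℂ] H, IsSymmetricPencil T B := by
  choose T' hd hb using hderiv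
  have hd₀ (z : ℂ) : HasOpDerivAt T (T' 0) z := HasOpDerivAt.eq_of_norm_le hd hb 0 z ▸ hd z
  set L : D →L[ℂ] H := (T' 0).mkContinuous C (hb 0)
  have hdense : DenseRange D.subtypeL := hD.denseRange_val
  refine ⟨L.extend D.subtypeL, fun z w f => ?_, fun x f g => ?_⟩
  · rw [HasOpDerivAt.apply_eq_add_smul hd₀ z w f]
    congr 2
    exact (L.extend_eq hdense (isUniformInducing_val _) f).symm
  · have hadj := (LinearPMap.mk D (T x)).adjoint_isFormalAdjoint hD
    rw [LinearPMap.isSelfAdjoint_def.1 (hsa x)] at hadj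
    exact hadj f g

end UnboundedOp

end Liouville

section RealEigenvalue

namespace UnboundedOp

variable {H : Type*} [NormedAddCommGroup H] [InnerProductSpace ℂ H] [CompleteSpace H]
  {D : Submodule ℂ H} {T : ℂ → D →ₗ[ℂ] H} {B : H →L[ℂ] H} {m : ℕ}

theorem IsSymmetricPencil.exists_isRealBranchAt (hT : IsSymmetricPencil T B)
    (hdisc : ∀ x : ℝ, HasDiscreteSpectrum ⟨D, T x⟩) {J : Set ℝ} (hJ : IsOpen J) {μ : ℝ → ℝ}
    (hμ : ContinuousOn μ J) (hm : ∀ x ∈ J, IsEigenvalueOfMultiplicity ⟨D, T x⟩ (μ x) m) :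
    ∃ Q : ℝ → H →L[ℂ] H, ∀ x ∈ J, IsRealBranchAt T m (fun y => ((μ y : ℂ), Q y)) x ∧
      IsEigenprojector ⟨D, T x⟩ (μ x) (Q x) := by
  have hlocal : ∀ x ∈ J, ∃ G, IsBranchAt T m G x ∧ ∀ᶠ y : ℝ in 𝓝 x,
      (G y).1 = μ y ∧ IsEigenprojector ⟨D, T y⟩ (μ y) (G y).2 := fun x hx =>
    hT.exists_isBranchAt_of_constant_multiplicity (hdisc x) (hμ.continuousAt (hJ.mem_nhds hx))
      ((hJ.eventually_mem hx).mono hm)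
  choose! G hG hGμ using hlocal
  have hQ (x : ℝ) (hx : x ∈ J) := (hGμ x hx).self_of_nhds.2
  refine ⟨fun x => (G x x).2, fun x hx => ⟨⟨G x, hG x hx, ?_⟩, hQ x hx⟩⟩
  filter_upwards [hGμ x hx, hJ.eventually_mem hx] with y hy hyJ
  exact Prod.ext hy.1.symm ((hQ y hyJ).eq hy.2)

end UnboundedOp

end RealEigenvalue

theorem isOpen_coe_mem_Ioo (a b : EReal) : IsOpen {x : ℝ | a < (x : EReal) ∧ (x : EReal) < b} :=
  isOpen_Ioo.preimage continuous_coe_real_ereal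

theorem ordConnected_coe_mem_Ioo (a b : EReal) :
    {x : ℝ | a < (x : EReal) ∧ (x : EReal) < b}.OrdConnected :=
  Set.ordConnected_Ioo.preimage_mono fun _ _ => EReal.coe_le_coe

theorem theorem1 {H : Type*} [NormedAddCommGroup H] [InnerProductSpace ℂ H] [CompleteSpace H]
    (D : Submodule ℂ H) (hD : Dense (D : Set H))
    (T : ℂ → D →ₗ[ℂ] H)
    (hclosed : ∀ z : ℂ, (LinearPMap.mk D (T z)).IsClosed)
    (hanalytic : ∀ (f : D) (g : H), AnalyticOnNhd ℂ (fun z => inner ℂ g (T z f)) Set.univ)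
    (hsa : ∀ x : ℝ, IsSelfAdjoint (LinearPMap.mk D (T (x : ℂ))))
    (hdisc : ∀ x : ℝ, UnboundedOp.HasDiscreteSpectrum (LinearPMap.mk D (T (x : ℂ))))
    (hderiv : ∃ C : ℝ, 0 < C ∧ ∀ z : ℂ, ∃ T' : D →ₗ[ℂ] H,
      UnboundedOp.HasOpDerivAt T T' z ∧ ∀ f : D, ‖T' f‖ ≤ C * ‖f‖)
    (a b : EReal) (hab : a < b) (m : ℕ)
    (μ : ℝ → ℝ) (hμ : ContinuousOn μ {x : ℝ | a < (x : EReal) ∧ (x : EReal) < b})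
    (hμT : ∀ x : ℝ, a < (x : EReal) → (x : EReal) < b →
      UnboundedOp.IsEigenvalueOfMultiplicity (LinearPMap.mk D (T (x : ℂ))) (μ x : ℂ) m) :
    ∃ (S : Set ℝ) (U : Set ℂ) (μ' : ℂ → ℂ) (P : ℂ → H →L[ℂ] H),
      (IsClosed S ∧ DiscreteTopology S) ∧
      IsOpen U ∧ IsConnected U ∧
      (∀ x : ℝ, x ∉ S → (x : ℂ) ∈ U) ∧
      (∀ x : ℝ, a < (x : EReal) → (x : EReal) < b → (x : ℂ) ∈ U) ∧
      AnalyticOnNhd ℂ μ' U ∧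
      (∀ x : ℝ, a < (x : EReal) → (x : EReal) < b → μ' (x : ℂ) = (μ x : ℂ)) ∧
      (∀ z ∈ U, UnboundedOp.IsEigenvalueOfMultiplicity (LinearPMap.mk D (T z)) (μ' z) m) ∧
      AnalyticOnNhd ℂ P U ∧
      ∀ z ∈ U, UnboundedOp.IsEigenprojector (LinearPMap.mk D (T z)) (μ' z) (P z) := by
  obtain ⟨C, -, hC⟩ := hderiv
  obtain ⟨B, hT⟩ := UnboundedOp.exists_isSymmetricPencil hD hsa hC
  obtain ⟨x₀, hx₀⟩ := EReal.lt_iff_exists_real_btwn.1 hab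
  have hm : m ≠ 0 := (hμT x₀ hx₀.1 hx₀.2).1
  have hJ := isOpen_coe_mem_Ioo a b
  obtain ⟨Q, hQ⟩ := hT.exists_isRealBranchAt hdisc hJ hμ fun x hx => hμT x hx.1 hx.2
  have hp := hT.isContinuable_isRealBranchAt hdisc m
  obtain ⟨F, hF, hFQ⟩ := hp.exists_forall ((hJ.eventually_mem hx₀).mono fun x hx => (hQ x hx).1)
  have hFJ := hp.eqOn (ordConnected_coe_mem_Ioo a b).isPreconnected (fun x _ => hF x)
    (fun x hx => (hQ x hx).1) hx₀ hFQ
  obtain ⟨U, K, hUo, hUc, hUF, hKF, hKU, hK⟩ := UnboundedOp.exists_isConnected_isEigenprojector hF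
  exact ⟨{x | ¬ UnboundedOp.IsEigenprojector ⟨D, T x⟩ (F x).1 (F x).2}, U,
    fun z => (K z).1, fun z => (K z).2,
    UnboundedOp.isClosed_and_discreteTopology_not_isEigenprojector hF, hUo, hUc,
    fun x hx => (hUF x).2 (not_not.1 hx),
    fun x hax hxb => (hUF x).2 (hFJ ⟨hax, hxb⟩ ▸ (hQ x ⟨hax, hxb⟩).2),
    fun z hz => analyticAt_fst.comp (hKU z hz),
    fun x hax hxb => congrArg Prod.fst ((hKF x).trans (hFJ ⟨hax, hxb⟩)),
    fun z hz => ⟨hm, (hK z hz).1.2.1 ▸ (hK z hz).2⟩,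
    fun z hz => analyticAt_snd.comp (hKU z hz),
    fun z hz => (hK z hz).1⟩
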